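/- Let $\mathcal M$ be a $C^*$-algebra and let $E$ be a $C^*$-correspondence over $\mathcal M$, i.e. a right Hilbert $C^*$-module over $\mathcal M$ with a left action given by a $*$-homomorphism $\phi:\mathcal M\to\mathcal L(E)$ which is essential (the closed linear span of $\phi(\mathcal M)E$ is $E$). Assume in addition that the closed linear span of $\{\phi(\langle\xi,\zeta\rangle)\eta:\xi,\zeta,\eta\in E\}$ is $E$ (this is automatic if $E$ is full, i.e. if the inner products $\langle \xi,\zeta\rangle$ span a dense subspace of $\mathcal M$). Let $(\sigma,T)$ be a completely bounded covariant representation of $E$ on a Hilbert space $\mathcal H$: $\sigma:\mathcal M\to B(\mathcal H)$ is a $*$-homomorphism and $T:E\to B(\mathcal H)$ is a completely bounded linear bimodule map, $T(a\xi b)=\sigma(a)T(\xi)\sigma(b)$. Let $\widetilde T:E\otimes_\sigma\mathcal H\to\mathcal H$ be the bounded operator with $\widetilde T(\xi\otimes h)=T(\xi)h$, and let $$\widetilde T_n=\widetilde T(I_E\otimes\widetilde T)\cdots(I_{E^{\otimes n-1}}\otimes\widetilde T):E^{\otimes n}\otimes_\sigma\mathcal H\to\mathcal H\qquad(n\ge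 1).$$ Suppose that $(\sigma,T)$ is concave, that is, $$\|\widetilde T_2x\|^2+\|x\|^2\le 2\,\|(I_E\otimes\widetilde T)x\|^2\qquad\text{for all }x\in E^{\otimes 2}\otimes_\sigma\mathcal H .$$ Then $\mathcal H_\infty:=\bigcap_{n\ge1}\widetilde T_n(E^{\otimes n}\otimes_\sigma\mathcal H)$ is a $(\sigma,T)$-reducing subspace: it is closed and $\sigma(\mathcal M)$-invariant, and both $\mathcal H_\infty$ and $\mathcal H_\infty^\perp$ are invariant under $T(\xi)$ for every $\xi\in E$. Moreover, the restriction $(\rho,S):=(\sigma,T)|_{\mathcal H_\infty}$ is an isometric covariant representation of $E$ on $\mathcal H_\infty$, i.e. $S(\xi)^*S(\zeta)=\rho(\langle\xi,\zeta\rangle)$ for all $\xi,\zeta\in E$, and it is fully coisometric, i.e. $\widetilde S\widetilde S^*=I_{\mathcal H_\infty}$. -/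

import Mathlib

open scoped TensorProduct

noncomputable section

namespace CStarCorr

/-- A `C*`-correspondence over the `C*`-algebra `M`: a right Hilbert `C*`-module `E` over `M`
(a `CStarModule` over the opposite algebra, `ξ · b` being `MulOpposite.op b • ξ`, complete for its
norm) with a left action `φ` of `M` by adjointable operators, i.e. a `*`-homomorphism
`φ : M → 𝓛(E)`, which is essential: the closed linear span of `φ(M)E` is `E`. -/
class CStarCorrespondence (M E : Type*) [NonUnitalCStarAlgebra M] [PartialOrder M]
    [StarOrderedRing M] [NormedAddCommGroup E] [NormedSpace ℂ E] [CompleteSpace E]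
    [SMul Mᵐᵒᵖ E] [CStarModule Mᵐᵒᵖ E] where
  /-- the left action -/
  φ : M →ₙₐ[ℂ] (E →L[ℂ] E)
  inner_φ_left : ∀ (a : M) (ξ ζ : E), inner Mᵐᵒᵖ (φ a ξ) ζ = inner Mᵐᵒᵖ ξ (φ (star a) ζ)
  essential : closure (Submodule.span ℂ {η : E | ∃ (a : M) (ξ : E), η = φ a ξ} : Set E) = Set.univ

set_option linter.unusedSectionVars false

section Module

/-- A self-adjoint `a` is of the form `d* d` unless `b a b = -b³` for some nonzero `b = c* c`. -/
lemma exists_negPart {A : Type*} [NonUnitalCStarAlgebra A] [PartialOrder A] [StarOrderedRing A]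
    (a : A) (ha : star a = a) : ∃ b c : A, b = star c * c ∧ b * a * b = -(b * b * b) ∧
      (b * b * b = 0 → ∃ d, a = star d * d) := by
  have hB0 : 0 ≤ a⁻ := CFC.negPart_nonneg a
  have hBs : star a⁻ = a⁻ := IsSelfAdjoint.of_nonneg hB0
  obtain ⟨C, hC⟩ := CStarAlgebra.nonneg_iff_eq_star_mul_self.mp hB0
  refine ⟨a⁻, C, hC, ?_, fun h => ?_⟩
  · have h : a⁻ * a = a⁻ * (a⁺ - a⁻) := by rw [CFC.posPart_sub_negPart a ha]
    rw [h, mul_sub, CFC.negPart_mul_posPart, zero_sub, neg_mul]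
  · have h1 : a⁻ * a⁻ = 0 := by
      rw [← norm_eq_zero, ← mul_self_eq_zero, ← CStarRing.norm_star_mul_self]
      simp only [star_mul, hBs]
      rw [← mul_assoc, h, zero_mul, norm_zero]
    have h2 : a⁻ = 0 := by
      rw [← norm_eq_zero, ← mul_self_eq_zero, ← CStarRing.norm_star_mul_self, hBs, h1, norm_zero]
    exact CStarAlgebra.nonneg_iff_eq_star_mul_self.mp ((CFC.negPart_eq_zero_iff a ha).mp h2)

variable {M E : Type*} [NonUnitalCStarAlgebra M] [PartialOrder M] [StarOrderedRing M]
  [NormedAddCommGroup E] [NormedSpace ℂ E] [SMul Mᵐᵒᵖ E] [CStarModule Mᵐᵒᵖ E]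

variable (M) in
/-- The `M`-valued inner product of a right Hilbert `C*`-module over `M`, conjugate linear in the
first variable, with `⟨ξ, ζ · b⟩ = ⟨ξ, ζ⟩ b`. -/
def mip (ξ ζ : E) : M := (inner Mᵐᵒᵖ ξ ζ).unop

lemma mip_add_right (x y z : E) : mip M x (y + z) = mip M x y + mip M x z := by
  simp [mip]

lemma mip_add_left (x y z : E) : mip M (x + y) z = mip M x z + mip M y z := by
  simp [mip]

lemma mip_smul_right (c : ℂ) (x y : E) : mip M x (c • y) = c • mip M x y := by
  simp [mip]

lemma mip_smul_left (c : ℂ) (x y : E) : mip M (c • x) y = star c • mip M x y := by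
  simp [mip, CStarModule.inner_smul_left_complex]

lemma star_mip (x y : E) : star (mip M x y) = mip M y x := by
  rw [mip, ← MulOpposite.unop_star, CStarModule.star_inner]; rfl

lemma mip_act_right (b : M) (x y : E) : mip M x (MulOpposite.op b • y) = mip M x y * b := by
  simp [mip]

lemma mip_act_left (b : M) (x y : E) : mip M (MulOpposite.op b • x) y = star b * mip M x y := by
  rw [← star_mip, mip_act_right, star_mul, star_mip]

lemma mip_self_nonneg (x : E) : 0 ≤ mip M x x :=
  (CStarModule.inner_self_nonneg (A := Mᵐᵒᵖ) (x := x))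

variable (M) in
def mipₗ : E →ₗ⋆[ℂ] E →ₗ[ℂ] M :=
  LinearMap.mk₂'ₛₗ (starRingEnd ℂ) (RingHom.id ℂ) (fun x y => mip M x y)
    mip_add_left (fun c x y => mip_smul_left c x y) mip_add_right (fun c x y => mip_smul_right c x y)

lemma mip_sum_left {ι : Type*} (s : Finset ι) (x : ι → E) (y : E) :
    mip M (∑ i ∈ s, x i) y = ∑ i ∈ s, mip M (x i) y :=
  LinearMap.map_sum₂ (mipₗ M (E := E)) s x y

lemma mip_sum_right {ι : Type*} (s : Finset ι) (x : E) (y : ι → E) :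
    mip M x (∑ i ∈ s, y i) = ∑ i ∈ s, mip M x (y i) :=
  map_sum (mipₗ M x) y s

/-- Gram matrices `(⟨ξ i, ξ j⟩)` are positive in the matrix algebra, i.e. of the form `C* C`. -/
lemma exists_gram_eq {ι : Type*} [Fintype ι] (ξ : ι → E) :
    ∃ C : ι → ι → M, ∀ i j, mip M (ξ i) (ξ j) = ∑ k, star (C k i) * C k j := by
  set G : CStarMatrix ι ι M := CStarMatrix.ofMatrix fun i j => mip M (ξ i) (ξ j) with hGdef
  have hGa : ∀ i j, G i j = mip M (ξ i) (ξ j) := fun i j => rfl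
  have hG : star G = G := by
    ext i j
    rw [CStarMatrix.star_apply, hGa, hGa, star_mip]
  obtain ⟨B, C, hBC, h1, h2⟩ := exists_negPart G hG
  have hBs : star B = B := by rw [hBC, star_mul, star_star]
  have hBs' : ∀ i j, star (B i j) = B j i := fun i j => by
    conv_rhs => rw [← hBs]
    rfl
  have h3 : ∀ j, (B * G * B) j j =
      mip M (∑ i, MulOpposite.op (B i j) • ξ i) (∑ i, MulOpposite.op (B i j) • ξ i) := by
    intro j
    rw [CStarMatrix.mul_apply]
    simp only [mip_sum_left, mip_sum_right, mip_act_left, mip_act_right, CStarMatrix.mul_apply,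
      Finset.sum_mul, hBs', hGa]
  have h4 : B * B * B = star (C * B) * (C * B) := by
    rw [star_mul, hBs]
    nth_rw 2 [hBC]
    simp only [mul_assoc]
  have h5 : C * B = 0 := by
    ext i j
    have h6 : ∑ k, star ((C * B) k j) * (C * B) k j ≤ 0 := by
      have : (B * B * B) j j = ∑ k, star ((C * B) k j) * (C * B) k j := by
        rw [h4, CStarMatrix.mul_apply]; rfl
      rw [← this, ← neg_nonneg]
      have h7 : -((B * B * B) j j) = (B * G * B) j j := by rw [h1]; rfl
      rw [h7, h3]
      exact mip_self_nonneg _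
    have h8 := Finset.sum_nonneg (s := Finset.univ)
      (fun k _ => star_mul_self_nonneg ((C * B) k j))
    have h9 := (Finset.sum_eq_zero_iff_of_nonneg
      (fun k _ => star_mul_self_nonneg ((C * B) k j))).mp (le_antisymm h6 h8) i (Finset.mem_univ i)
    rw [← norm_eq_zero, CStarRing.norm_star_mul_self, mul_self_eq_zero, norm_eq_zero] at h9
    exact h9
  obtain ⟨D, hD⟩ := h2 (by rw [h4, h5, mul_zero])
  refine ⟨fun i j => D i j, fun i j => ?_⟩
  rw [← hGa, hD, CStarMatrix.mul_apply]
  rfl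

end Module

section InteriorTensor

variable {M : Type*} (E : Type*) [NonUnitalCStarAlgebra M] [PartialOrder M] [StarOrderedRing M]
  [NormedAddCommGroup E] [NormedSpace ℂ E] [CompleteSpace E] [SMul Mᵐᵒᵖ E] [CStarModule Mᵐᵒᵖ E]
  [CStarCorrespondence M E]
  {H : Type*} [NormedAddCommGroup H] [InnerProductSpace ℂ H] [CompleteSpace H]
  (σ : M →⋆ₙₐ[ℂ] (H →L[ℂ] H))

/-- The algebraic tensor product of `E` and `H`, to be equipped with the semi-inner product
`⟨ξ ⊗ h, ζ ⊗ k⟩ = ⟨h, σ(⟨ξ, ζ⟩) k⟩`. -/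
def PreTensor (_σ : M →⋆ₙₐ[ℂ] (H →L[ℂ] H)) : Type _ := E ⊗[ℂ] H

instance : AddCommGroup (PreTensor E σ) := inferInstanceAs (AddCommGroup (E ⊗[ℂ] H))
instance : Module ℂ (PreTensor E σ) := inferInstanceAs (Module ℂ (E ⊗[ℂ] H))

/-- The elementary tensor `ξ ⊗ h` in the algebraic tensor product. -/
def pre (ξ : E) (h : H) : PreTensor E σ := ξ ⊗ₜ[ℂ] h

variable {E} in
/-- The functional `ζ ⊗ k ↦ ⟨h, σ(⟨ξ, ζ⟩) k⟩`. -/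
def preFunctional (ξ : E) (h : H) : PreTensor E σ →ₗ[ℂ] ℂ :=
  (TensorProduct.lift (LinearMap.mk₂ ℂ
    (fun (ζ : E) (k : H) => inner ℂ h (σ (mip M ξ ζ) k))
    (fun ζ ζ' k => by simp [mip_add_right])
    (fun c ζ k => by simp [mip_smul_right])
    (fun ζ k k' => by simp)
    (fun c ζ k => by simp)) : E ⊗[ℂ] H →ₗ[ℂ] ℂ)

lemma preFunctional_pre (ξ ζ : E) (h k : H) :
    preFunctional σ ξ h (pre E σ ζ k) = inner ℂ h (σ (mip M ξ ζ) k) := rfl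

variable {E σ} in
lemma pre_ext {V : Type*} [AddCommGroup V] [Module ℂ V] {f g : PreTensor E σ →ₗ[ℂ] V}
    (h : ∀ ξ k, f (pre E σ ξ k) = g (pre E σ ξ k)) : f = g :=
  TensorProduct.ext' (g := (f : E ⊗[ℂ] H →ₗ[ℂ] V)) (h := (g : E ⊗[ℂ] H →ₗ[ℂ] V)) h

/-- The sesquilinear form with `⟨ξ ⊗ h, ζ ⊗ k⟩ = ⟨h, σ(⟨ξ, ζ⟩) k⟩`. -/
def preInner : PreTensor E σ →ₗ⋆[ℂ] PreTensor E σ →ₗ[ℂ] ℂ :=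
  (TensorProduct.lift (LinearMap.mk₂'ₛₗ (starRingEnd ℂ) (starRingEnd ℂ)
    (fun (ξ : E) (h : H) => preFunctional σ ξ h)
    (fun ξ ξ' h => pre_ext fun ζ k => by simp [preFunctional_pre, mip_add_left])
    (fun c ξ h => pre_ext fun ζ k => by simp [preFunctional_pre, mip_smul_left])
    (fun ξ h h' => pre_ext fun ζ k => by simp [preFunctional_pre])
    (fun c ξ h => pre_ext fun ζ k => by
      simp [preFunctional_pre, mul_comm])) : E ⊗[ℂ] H →ₗ⋆[ℂ] PreTensor E σ →ₗ[ℂ] ℂ)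

lemma preInner_pre (ξ ζ : E) (h k : H) :
    preInner E σ (pre E σ ξ h) (pre E σ ζ k) = inner ℂ h (σ (mip M ξ ζ) k) := rfl

variable {E σ} in
lemma exists_sum_pre (x : PreTensor E σ) :
    ∃ (n : ℕ) (ξ : Fin n → E) (h : Fin n → H), x = ∑ i, pre E σ (ξ i) (h i) := by
  obtain ⟨S, hS⟩ := TensorProduct.exists_finset (R := ℂ) (M := E) (N := H) x
  refine ⟨S.card, fun i => (S.equivFin.symm i).1.1, fun i => (S.equivFin.symm i).1.2, ?_⟩
  rw [Equiv.sum_comp S.equivFin.symm (fun p => pre E σ p.1.1 p.1.2),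
    Finset.sum_coe_sort S (fun p => pre E σ p.1 p.2)]
  exact hS

variable {E σ} in
lemma pre_induction {p : PreTensor E σ → Prop} (h0 : p 0) (h1 : ∀ ξ h, p (pre E σ ξ h))
    (h2 : ∀ x y, p x → p y → p (x + y)) (x : PreTensor E σ) : p x :=
  TensorProduct.induction_on (motive := p) x h0 h1 h2

lemma preInner_symm (x y : PreTensor E σ) :
    starRingEnd ℂ (preInner E σ y x) = preInner E σ x y := by
  induction x using pre_induction with
  | h0 => simp
  | h2 x x' hx hx' => simp [hx, hx']
  | h1 ξ h =>
    induction y using pre_induction with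
    | h0 => simp
    | h2 y y' hy hy' => simp [hy, hy']
    | h1 ζ k =>
      rw [preInner_pre, preInner_pre, inner_conj_symm, ← star_mip, map_star,
        ContinuousLinearMap.star_eq_adjoint, ContinuousLinearMap.adjoint_inner_left]

lemma preInner_nonneg (x : PreTensor E σ) : 0 ≤ RCLike.re (preInner E σ x x) := by
  obtain ⟨n, ξ, h, rfl⟩ := exists_sum_pre x
  obtain ⟨C, hC⟩ := exists_gram_eq (M := M) ξ
  have : preInner E σ (∑ i, pre E σ (ξ i) (h i)) (∑ i, pre E σ (ξ i) (h i)) =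
      ∑ k, inner ℂ (∑ i, σ (C k i) (h i)) (∑ i, σ (C k i) (h i)) := by
    simp only [map_sum, LinearMap.sum_apply, preInner_pre, hC, inner_sum, sum_inner,
      sum_apply, map_mul, map_star, mul_apply_eq_comp,
      ContinuousLinearMap.star_eq_adjoint, ContinuousLinearMap.adjoint_inner_right]
    rw [Finset.sum_comm]
    conv_lhs => enter [2, i]; rw [Finset.sum_comm]
    rw [Finset.sum_comm]
    refine Finset.sum_congr rfl fun k _ => Finset.sum_comm
  rw [this, map_sum]
  exact Finset.sum_nonneg fun k _ => inner_self_nonneg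

@[reducible] def preCore : PreInnerProductSpace.Core ℂ (PreTensor E σ) where
  inner x y := preInner E σ x y
  conj_inner_symm x y := preInner_symm E σ x y
  re_inner_nonneg x := preInner_nonneg E σ x
  add_left x y z := by simp
  smul_left x y r := by simp

instance : SeminormedAddCommGroup (PreTensor E σ) :=
  @InnerProductSpace.Core.toSeminormedAddCommGroup ℂ (PreTensor E σ) _ _ _ (preCore E σ)

instance : InnerProductSpace ℂ (PreTensor E σ) := InnerProductSpace.ofCore (preCore E σ)

lemma inner_eq_preInner (x y : PreTensor E σ) : inner ℂ x y = preInner E σ x y := rfl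

/-- The interior tensor product `E ⊗_σ H`: the Hilbert space obtained from the algebraic tensor
product with `⟨ξ ⊗ h, ζ ⊗ k⟩ = ⟨h, σ(⟨ξ, ζ⟩) k⟩` by separation and completion. -/
abbrev ITensor : Type _ := UniformSpace.Completion (PreTensor E σ)

/-- The canonical map from the algebraic tensor product to `E ⊗_σ H`. -/
abbrev toITensor : PreTensor E σ →ₗ[ℂ] ITensor E σ :=
  (UniformSpace.Completion.toComplₗᵢ (𝕜 := ℂ) (E := PreTensor E σ)).toLinearMap

/-- The elementary tensor `ξ ⊗ h` in `E ⊗_σ H`. -/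
def tmul (ξ : E) (h : H) : ITensor E σ := toITensor E σ (pre E σ ξ h)

lemma inner_tmul (ξ ζ : E) (h k : H) :
    inner ℂ (tmul E σ ξ h) (tmul E σ ζ k) = inner ℂ h (σ (mip M ξ ζ) k) := by
  simp [tmul, inner_eq_preInner, preInner_pre]

/-- The algebraic form of `φ(a) ⊗ I`. -/
def preLeft : M →ₙₐ[ℂ] Module.End ℂ (PreTensor E σ) where
  toFun a := (TensorProduct.map (CStarCorrespondence.φ a : E →L[ℂ] E).toLinearMap LinearMap.id :
    E ⊗[ℂ] H →ₗ[ℂ] E ⊗[ℂ] H)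
  map_smul' c a := pre_ext fun ξ k => by
    change pre E σ (CStarCorrespondence.φ (c • a) ξ) k = c • pre E σ (CStarCorrespondence.φ a ξ) k
    rw [map_smul]
    rfl
  map_zero' := pre_ext fun ξ k => by
    change pre E σ (CStarCorrespondence.φ (0 : M) ξ) k = 0
    rw [map_zero]
    exact TensorProduct.zero_tmul _ _
  map_add' a b := pre_ext fun ξ k => by
    change pre E σ (CStarCorrespondence.φ (a + b) ξ) k =
      pre E σ (CStarCorrespondence.φ a ξ) k + pre E σ (CStarCorrespondence.φ b ξ) k
    rw [map_add]
    exact TensorProduct.add_tmul _ _ _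
  map_mul' a b := pre_ext fun ξ k => by
    change pre E σ (CStarCorrespondence.φ (a * b) ξ) k =
      pre E σ (CStarCorrespondence.φ a (CStarCorrespondence.φ b ξ)) k
    rw [map_mul]
    rfl

lemma preLeft_pre (a : M) (ξ : E) (h : H) :
    preLeft E σ a (pre E σ ξ h) = pre E σ (CStarCorrespondence.φ a ξ) h := rfl

lemma mip_φ_left (a : M) (ξ ζ : E) :
    mip M (CStarCorrespondence.φ a ξ) ζ = mip M ξ (CStarCorrespondence.φ (star a) ζ) := by
  simp only [mip, CStarCorrespondence.inner_φ_left]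

lemma inner_preLeft (a : M) (x y : PreTensor E σ) :
    inner ℂ (preLeft E σ a x) y = inner ℂ x (preLeft E σ (star a) y) := by
  induction x using pre_induction with
  | h0 => simp
  | h2 x x' hx hx' => simp [hx, hx', inner_add_left]
  | h1 ξ h =>
    induction y using pre_induction with
    | h0 => simp
    | h2 y y' hy hy' => simp [hy, hy', inner_add_right]
    | h1 ζ k =>
      simp only [preLeft_pre, inner_eq_preInner, preInner_pre, mip_φ_left]

lemma norm_preLeft_le (a : M) (x : PreTensor E σ) : ‖preLeft E σ a x‖ ≤ ‖a‖ * ‖x‖ := by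
  let _ : PartialOrder (Unitization ℂ M) := CStarAlgebra.spectralOrder _
  let _ : StarOrderedRing (Unitization ℂ M) := CStarAlgebra.spectralOrderedRing _
  set L : Unitization ℂ M →ₐ[ℂ] Module.End ℂ (PreTensor E σ) := Unitization.lift (preLeft E σ)
    with hL
  have hLs : ∀ (c : Unitization ℂ M) (x y : PreTensor E σ),
      inner ℂ (L c x) y = inner ℂ x (L (star c) y) := by
    intro c x y
    induction c using Unitization.ind with
    | inl_add_inr r m =>
      simp [hL, inner_add_left, inner_add_right, inner_smul_left, inner_smul_right, inner_preLeft,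
        Module.algebraMap_end_apply]
  have h0 : star (a : Unitization ℂ M) * a ≤ algebraMap ℝ _ ‖star (a : Unitization ℂ M) * a‖ :=
    IsSelfAdjoint.le_algebraMap_norm_self (.star_mul_self _)
  obtain ⟨c, hc⟩ := CStarAlgebra.nonneg_iff_eq_star_mul_self.mp (sub_nonneg.mpr h0)
  have h1 : 0 ≤ RCLike.re (inner ℂ x (L (star c * c) x)) := by
    rw [map_mul, Module.End.mul_apply, ← hLs]
    exact inner_self_nonneg
  have h2 : algebraMap ℝ (Unitization ℂ M) ‖star (a : Unitization ℂ M) * a‖ =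
      algebraMap ℂ (Unitization ℂ M) ((‖a‖ ^ 2 : ℝ) : ℂ) := by
    rw [CStarRing.norm_star_mul_self, Unitization.norm_inr, ← pow_two]
    rfl
  have hLa : L (a : Unitization ℂ M) = preLeft E σ a := by
    simp [hL]
  rw [← hc, map_sub, h2, AlgHom.commutes, map_mul, LinearMap.sub_apply, Module.End.mul_apply,
    inner_sub_right, ← hLs, hLa, Module.algebraMap_end_apply, inner_smul_right] at h1
  have h3 : ‖preLeft E σ a x‖ ^ 2 ≤ (‖a‖ * ‖x‖) ^ 2 := by
    rw [map_sub, RCLike.re_eq_complex_re, Complex.re_ofReal_mul] at h1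
    have e1 := norm_sq_eq_re_inner (𝕜 := ℂ) (preLeft E σ a x)
    have e2 := norm_sq_eq_re_inner (𝕜 := ℂ) x
    rw [RCLike.re_eq_complex_re] at e1 e2
    rw [mul_pow, e1, e2]
    linarith
  exact le_of_sq_le_sq h3 (by positivity)

lemma denseRange_toITensor : DenseRange (toITensor E σ) :=
  UniformSpace.Completion.denseRange_coe

variable {E σ} in
lemma ITensor.ext_clm {V : Type*} [NormedAddCommGroup V] [NormedSpace ℂ V]
    {f g : ITensor E σ →L[ℂ] V} (h : ∀ ξ k, f (tmul E σ ξ k) = g (tmul E σ ξ k)) : f = g := by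
  have h1 : f.toLinearMap ∘ₗ toITensor E σ = g.toLinearMap ∘ₗ toITensor E σ := pre_ext h
  exact ContinuousLinearMap.coeFn_injective
    ((denseRange_toITensor E σ).equalizer f.continuous g.continuous
      (funext fun x => LinearMap.congr_fun h1 x))

/-- The operator `φ(a) ⊗ I` on `E ⊗_σ H`. -/
def leftCLM (a : M) : ITensor E σ →L[ℂ] ITensor E σ :=
  (toITensor E σ ∘ₗ preLeft E σ a).extendOfNorm (toITensor E σ)

lemma leftCLM_coe (a : M) (x : PreTensor E σ) :
    leftCLM E σ a (toITensor E σ x) = toITensor E σ (preLeft E σ a x) :=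
  LinearMap.extendOfNorm_eq (denseRange_toITensor E σ)
    ⟨‖a‖, fun x => by simpa using norm_preLeft_le E σ a x⟩ x

lemma leftCLM_tmul (a : M) (ξ : E) (h : H) :
    leftCLM E σ a (tmul E σ ξ h) = tmul E σ (CStarCorrespondence.φ a ξ) h :=
  leftCLM_coe E σ a (pre E σ ξ h)

/-- The representation `a ↦ φ(a) ⊗ I` of `M` on `E ⊗_σ H`. -/
def leftRep : M →⋆ₙₐ[ℂ] (ITensor E σ →L[ℂ] ITensor E σ) where
  toFun a := leftCLM E σ a
  map_smul' c a := ITensor.ext_clm fun ξ k => by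
    change leftCLM E σ (c • a) (tmul E σ ξ k) = c • leftCLM E σ a (tmul E σ ξ k)
    rw [tmul, leftCLM_coe, leftCLM_coe, map_smul, LinearMap.smul_apply, map_smul]
  map_zero' := ITensor.ext_clm fun ξ k => by
    rw [tmul, leftCLM_coe, map_zero, LinearMap.zero_apply, map_zero]
    rfl
  map_add' a b := ITensor.ext_clm fun ξ k => by
    change leftCLM E σ (a + b) (tmul E σ ξ k) =
      leftCLM E σ a (tmul E σ ξ k) + leftCLM E σ b (tmul E σ ξ k)
    simp only [tmul, leftCLM_coe, map_add, LinearMap.add_apply]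
  map_mul' a b := ITensor.ext_clm fun ξ k => by
    change leftCLM E σ (a * b) (tmul E σ ξ k) = leftCLM E σ a (leftCLM E σ b (tmul E σ ξ k))
    simp only [tmul, leftCLM_coe, map_mul, Module.End.mul_apply]
  map_star' a := by
    rw [ContinuousLinearMap.star_eq_adjoint, ContinuousLinearMap.eq_adjoint_iff]
    intro x y
    induction x, y using UniformSpace.Completion.induction_on₂ with
    | hp => exact isClosed_eq (by fun_prop) (by fun_prop)
    | ih x y =>
      change inner ℂ (leftCLM E σ (star a) (toITensor E σ x)) (toITensor E σ y) =
        inner ℂ (toITensor E σ x) (leftCLM E σ a (toITensor E σ y))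
      rw [leftCLM_coe, leftCLM_coe]
      simpa using inner_preLeft E σ (star a) x y

variable {H' : Type*} [NormedAddCommGroup H'] [InnerProductSpace ℂ H'] [CompleteSpace H']
  (ρ : M →⋆ₙₐ[ℂ] (H' →L[ℂ] H'))

/-- The operator `I_E ⊗ X : E ⊗_σ H → E ⊗_ρ H'` for an operator `X : H → H'` which intertwines
`σ` and `ρ`: the continuous extension of `ξ ⊗ h ↦ ξ ⊗ X h`. -/
def idTensor (X : H →L[ℂ] H') : ITensor E σ →L[ℂ] ITensor E ρ :=
  (toITensor E ρ ∘ₗ (TensorProduct.map LinearMap.id X.toLinearMap :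
    E ⊗[ℂ] H →ₗ[ℂ] E ⊗[ℂ] H')).extendOfNorm (toITensor E σ)

end InteriorTensor

/-- A representation of the `C*`-algebra `M` on a Hilbert space. -/
structure HilbertRep.{u, w} (M : Type u) [NonUnitalCStarAlgebra M] : Type (max u (w + 1)) where
  carrier : Type w
  [toNormedAddCommGroup : NormedAddCommGroup carrier]
  [toInnerProductSpace : InnerProductSpace ℂ carrier]
  [toCompleteSpace : CompleteSpace carrier]
  rep : M →⋆ₙₐ[ℂ] (carrier →L[ℂ] carrier)

attribute [instance] HilbertRep.toNormedAddCommGroup HilbertRep.toInnerProductSpace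
  HilbertRep.toCompleteSpace

section Covariant

universe u v w

variable {M : Type u} {E : Type v} {H : Type w} [NonUnitalCStarAlgebra M] [PartialOrder M]
  [StarOrderedRing M] [NormedAddCommGroup E] [NormedSpace ℂ E] [CompleteSpace E] [SMul Mᵐᵒᵖ E]
  [CStarModule Mᵐᵒᵖ E] [CStarCorrespondence M E]
  [NormedAddCommGroup H] [InnerProductSpace ℂ H] [CompleteSpace H]

variable (E) in
/-- `powTensor E σ n` is the Hilbert space `E^{⊗(n+1)} ⊗_σ H = E ⊗ (E ⊗ (⋯ (E ⊗_σ H)))`, with the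
representation `a ↦ φ(a) ⊗ I` of `M` (the left action on the leftmost factor). -/
def powTensor (σ : M →⋆ₙₐ[ℂ] (H →L[ℂ] H)) : ℕ → HilbertRep.{u, max v w} M
  | 0 => ⟨ITensor E σ, leftRep E σ⟩
  | n + 1 => ⟨ITensor E (powTensor σ n).rep, leftRep E (powTensor σ n).rep⟩

variable (M E H) in
/-- A covariant representation `(σ, T)` of `E` on `H`: a representation `σ` of `M` on `H` and a
linear map `T : E → B(H)` with `T(a ξ b) = σ(a) T(ξ) σ(b)`, i.e. `T` is a bimodule map. -/
structure CovRep where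
  σ : M →⋆ₙₐ[ℂ] (H →L[ℂ] H)
  T : E →ₗ[ℂ] (H →L[ℂ] H)
  map_left : ∀ (a : M) (ξ : E), T (CStarCorrespondence.φ a ξ) = σ a ∘L T ξ
  map_right : ∀ (ξ : E) (b : M), T (MulOpposite.op b • ξ) = T ξ ∘L σ b

namespace CovRep

variable (R : CovRep M E H)

/-- `T` is completely bounded: there is `C` with `‖[T(ξ_ij)]‖ ≤ C ‖[ξ_ij]‖` for all matrices
`[ξ_ij]` over `E` of all sizes, where `‖[T(ξ_ij)]‖` is the norm in `M_n(B(H))` and the operator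
space norm on `M_n(E)` is that of the corner `E` of the linking algebra,
`‖[ξ_ij]‖ = ‖[∑_k ⟨ξ_ki, ξ_kj⟩]‖^{1/2}` with the norm of `M_n(M)` on the right. -/
def IsCompletelyBounded : Prop :=
  ∃ C : ℝ, ∀ (n : ℕ) (ξ : Fin n → Fin n → E),
    ‖(CStarMatrix.ofMatrix fun i j => R.T (ξ i j) : CStarMatrix (Fin n) (Fin n) (H →L[ℂ] H))‖ ≤
      C * √‖(CStarMatrix.ofMatrix fun i j => ∑ k, mip M (ξ k i) (ξ k j) :
        CStarMatrix (Fin n) (Fin n) M)‖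

/-- The linear map `ξ ⊗ h ↦ T(ξ) h` on the algebraic tensor product. -/
def preTilde : PreTensor E R.σ →ₗ[ℂ] H :=
  (TensorProduct.lift (LinearMap.mk₂ ℂ (fun (ξ : E) (h : H) => R.T ξ h)
    (fun ξ ξ' h => by simp) (fun c ξ h => by simp) (fun ξ h h' => by simp)
    (fun c ξ h => by simp)) : E ⊗[ℂ] H →ₗ[ℂ] H)

/-- The bounded operator `T̃ : E ⊗_σ H → H` with `T̃(ξ ⊗ h) = T(ξ) h`: the continuous extension of
`preTilde` (which is bounded for a completely bounded `T`; the value is `0` if it is not). -/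
def tilde : ITensor E R.σ →L[ℂ] H := R.preTilde.extendOfNorm (toITensor E R.σ)

/-- `R.tildePow n` is the operator
`T̃_{n+1} = T̃ (I_E ⊗ T̃) ⋯ (I_{E^{⊗n}} ⊗ T̃) : E^{⊗(n+1)} ⊗_σ H → H`,
`ξ_1 ⊗ ⋯ ⊗ ξ_{n+1} ⊗ h ↦ T(ξ_1) ⋯ T(ξ_{n+1}) h`, obtained recursively from `T̃_1 = T̃` and
`T̃_{n+2} = T̃ (I_E ⊗ T̃_{n+1})`. -/
def tildePow : (n : ℕ) → (powTensor E R.σ n).carrier →L[ℂ] H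
  | 0 => R.tilde
  | n + 1 => R.tilde ∘L idTensor E (powTensor E R.σ n).rep R.σ (tildePow n)

/-- `(σ, T)` is concave:
`‖T̃_2 x‖² + ‖x‖² ≤ 2 ‖(I_E ⊗ T̃) x‖²` for all `x` in `E^{⊗2} ⊗_σ H = E ⊗ (E ⊗_σ H)`. -/
def IsConcave : Prop :=
  ∀ x : (powTensor E R.σ 1).carrier,
    ‖R.tildePow 1 x‖ ^ 2 + ‖x‖ ^ 2 ≤ 2 * ‖idTensor E (leftRep E R.σ) R.σ R.tilde x‖ ^ 2

/-- `(σ, T)` is isometric: `T(ξ)* T(ζ) = σ(⟨ξ, ζ⟩)`. -/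
def IsIsometric : Prop :=
  ∀ ξ ζ : E, ContinuousLinearMap.adjoint (R.T ξ) ∘L R.T ζ = R.σ (mip M ξ ζ)

/-- `(σ, T)` is fully co-isometric: `T̃ T̃* = I_H`. -/
def IsFullyCoisometric : Prop :=
  R.tilde ∘L ContinuousLinearMap.adjoint R.tilde = ContinuousLinearMap.id ℂ H

/-- `H_∞ = ⋂_{n ≥ 1} T̃_n(E^{⊗n} ⊗ H)`. -/
def Hinf : Submodule ℂ H := ⨅ n : ℕ, (R.tildePow n).range

/-- The subspace `K` is `(σ, T)`-reducing: it is closed, `σ(M)`-invariant (equivalently, as `σ(M)`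
is self-adjoint, the projection onto `K` is in the commutant of `σ(M)`), and both `K` and its
orthogonal complement are invariant under all `T(ξ)`. -/
structure IsReducing (K : Submodule ℂ H) : Prop where
  isClosed : IsClosed (K : Set H)
  σ_mem : ∀ (a : M), ∀ h ∈ K, R.σ a h ∈ K
  T_mem : ∀ (ξ : E), ∀ h ∈ K, R.T ξ h ∈ K
  T_mem_orthogonal : ∀ (ξ : E), ∀ h ∈ Kᗮ, R.T ξ h ∈ Kᗮ

lemma IsReducing.completeSpace {R : CovRep M E H} {K : Submodule ℂ H} (hK : R.IsReducing K) :
    CompleteSpace K := hK.isClosed.completeSpace_coe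

/-- The restriction of an operator to an invariant subspace. -/
def restrictCLM (K : Submodule ℂ H) (A : H →L[ℂ] H) (hA : ∀ h ∈ K, A h ∈ K) : K →L[ℂ] K :=
  (A.comp K.subtypeL).codRestrict K fun h => hA h h.2

@[simp] lemma coe_restrictCLM (K : Submodule ℂ H) (A : H →L[ℂ] H) (hA : ∀ h ∈ K, A h ∈ K) (h : K) :
    (restrictCLM K A hA h : H) = A h := rfl

/-- The restriction `(σ, T)|_K` to a reducing subspace `K`, a covariant representation on `K`. -/
def restrict (K : Submodule ℂ H) [CompleteSpace K] (hK : R.IsReducing K) : CovRep M E K where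
  σ :=
    { toFun := fun a => restrictCLM K (R.σ a) (hK.σ_mem a)
      map_smul' := fun c a => by ext; simp
      map_zero' := by ext; simp
      map_add' := fun a b => by ext; simp
      map_mul' := fun a b => by ext; simp
      map_star' := fun a => by
        rw [ContinuousLinearMap.star_eq_adjoint, ContinuousLinearMap.eq_adjoint_iff]
        intro x y
        simp [map_star, ContinuousLinearMap.star_eq_adjoint,
          ContinuousLinearMap.adjoint_inner_left] }
  T :=
    { toFun := fun ξ => restrictCLM K (R.T ξ) (hK.T_mem ξ)
      map_add' := fun ξ ζ => by ext; simp
      map_smul' := fun c ξ => by ext; simp }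
  map_left a ξ := by ext h; simp [R.map_left]
  map_right ξ b := by ext h; simp [R.map_right]

end CovRep

variable (M E) in
/-- The left action of the ideal of `M` generated by the inner products of `E` is essential: the
closed linear span of the elements `φ(⟨ξ, ζ⟩) η` is `E`. If `E` is full (the closed linear span of
the inner products is `M`), this follows from the essentiality of `φ`. -/
def InnerIdealEssential : Prop :=
  closure (Submodule.span ℂ {ω : E | ∃ ξ ζ η : E, ω = CStarCorrespondence.φ (mip M ξ ζ) η} :
    Set E) = Set.univ

end Covariant

end CStarCorr

end

/-! The engine is the recursion `c ↦ 1 / (2 - c)`, which sends `n / (n + 1)` to `(n + 1) / (n + 2)`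
and so climbs from `0` to `1`. Concavity drives it twice.

Lower bound (`IsConcave.norm_sq_le_tilde`): if `c ‖x‖² ≤ ‖T̃ x‖²` for all `x`, put `x = (I ⊗ T̃) z`
in the concavity inequality to get `‖z‖² ≤ (2 - c) ‖(I ⊗ T̃) z‖²`. Essentiality of the inner-product
ideal allows `I ⊗` to be removed (`le_norm_sq_of_idTensor`), so the bound for `T̃` holds with `1 /
(2 - c)`. In the limit `T̃` is expansive. Hence so are all `T̃_n`; their ranges are closed, and `T̃`
has a bounded left inverse `G` intertwining the representations.

Upper bound (`IsConcave.norm_tilde_sq_le`): let `T̃ x ∈ H_∞`. Injectivity of `T̃` puts all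
coefficients of `x` in `H_∞` (`IsConcave.annih_mem_Hinf`), so `x = (I ⊗ T̃) z` with `z = (I ⊗ G P)
x`, where `P` is the projection onto `H_∞`. Now `‖T̃ x‖² ≤ 2 ‖x‖² - ‖z‖²`, and the same recursion
yields `‖T̃ x‖ ≤ ‖x‖`.

Equality of norms together with `T̃* T̃ ≥ I` forces `T̃* T̃ x = x` (`adjoint_apply_of_expansive`).
Invariance of the orthogonal complement and the isometry relation follow by moving `T̃` across inner
products; full coisometry follows because `T̃` maps `E ⊗ H_∞` onto `H_∞`.

Independently, complete boundedness must be shown to make `T̃` a bounded operator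
(`IsCompletelyBounded.exists_norm_preTilde_le`). -/

open scoped TensorProduct

noncomputable section

namespace CStarCorr

set_option linter.unusedSectionVars false

/-! ### Amplifications `I_E ⊗ X` of intertwiners, and removal of `I_E ⊗` from inequalities. -/

section Amplification

variable {M : Type*} (E : Type*) [NonUnitalCStarAlgebra M] [PartialOrder M] [StarOrderedRing M]
  [NormedAddCommGroup E] [NormedSpace ℂ E] [CompleteSpace E] [SMul Mᵐᵒᵖ E] [CStarModule Mᵐᵒᵖ E]
  [CStarCorrespondence M E]
  {H H₁ H₂ : Type*} [NormedAddCommGroup H] [InnerProductSpace ℂ H] [CompleteSpace H]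
  [NormedAddCommGroup H₁] [InnerProductSpace ℂ H₁] [CompleteSpace H₁]
  [NormedAddCommGroup H₂] [InnerProductSpace ℂ H₂] [CompleteSpace H₂]
  (σ : M →⋆ₙₐ[ℂ] (H →L[ℂ] H)) (ρ : M →⋆ₙₐ[ℂ] (H₁ →L[ℂ] H₁)) (τ : M →⋆ₙₐ[ℂ] (H₂ →L[ℂ] H₂))

/-- The operator `X` intertwines the representations `σ` and `ρ`. -/
def Intertwines (X : H →L[ℂ] H₁) : Prop := ∀ (a : M) (h : H), X (σ a h) = ρ a (X h)

variable {σ ρ τ}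

lemma Intertwines.id : Intertwines σ σ (.id ℂ H) := fun _ _ => rfl

lemma Intertwines.comp {Y : H₁ →L[ℂ] H₂} {X : H →L[ℂ] H₁} (hY : Intertwines ρ τ Y)
    (hX : Intertwines σ ρ X) : Intertwines σ τ (Y ∘L X) := fun a h => by
  simp [hX a h, hY a]

lemma Intertwines.sub {X Y : H →L[ℂ] H₁} (hX : Intertwines σ ρ X) (hY : Intertwines σ ρ Y) :
    Intertwines σ ρ (X - Y) := fun a h => by simp [hX a h, hY a h]

lemma Intertwines.smul {X : H →L[ℂ] H₁} (c : ℂ) (hX : Intertwines σ ρ X) :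
    Intertwines σ ρ (c • X) := fun a h => by simp [hX a h]

lemma inner_rep_left (a : M) (x y : H) : inner ℂ (σ a x) y = inner ℂ x (σ (star a) y) := by
  rw [map_star, ContinuousLinearMap.star_eq_adjoint, ContinuousLinearMap.adjoint_inner_right]

lemma Intertwines.adjoint {X : H →L[ℂ] H₁} (hX : Intertwines σ ρ X) :
    Intertwines ρ σ (ContinuousLinearMap.adjoint X) := fun a h => by
  refine ext_inner_left ℂ fun v => ?_
  rw [ContinuousLinearMap.adjoint_inner_right, ← star_star a, ← inner_rep_left, ← inner_rep_left,
    ContinuousLinearMap.adjoint_inner_right, hX]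

/-- The algebraic form of `I_E ⊗ X`. -/
def preMap (σ : M →⋆ₙₐ[ℂ] (H →L[ℂ] H)) (ρ : M →⋆ₙₐ[ℂ] (H₁ →L[ℂ] H₁)) (X : H →L[ℂ] H₁) :
    PreTensor E σ →ₗ[ℂ] PreTensor E ρ :=
  (TensorProduct.map LinearMap.id X.toLinearMap : E ⊗[ℂ] H →ₗ[ℂ] E ⊗[ℂ] H₁)

@[simp] lemma preMap_pre (X : H →L[ℂ] H₁) (ξ : E) (h : H) :
    preMap E σ ρ X (pre E σ ξ h) = pre E ρ ξ (X h) := rfl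

variable {E}

/-- A factorization `C* C` of the Gram matrix turns a sum of elementary tensors into a vector of
`H^n` of the same norm. -/
lemma norm_sum_pre_sq {n : ℕ} (ξ : Fin n → E) (h : Fin n → H) (C : Fin n → Fin n → M)
    (hC : ∀ i j, mip M (ξ i) (ξ j) = ∑ k, star (C k i) * C k j) :
    ‖∑ i, pre E σ (ξ i) (h i)‖ ^ 2 = ∑ k, ‖∑ i, σ (C k i) (h i)‖ ^ 2 := by
  have : preInner E σ (∑ i, pre E σ (ξ i) (h i)) (∑ i, pre E σ (ξ i) (h i)) =
      ∑ k, inner ℂ (∑ i, σ (C k i) (h i)) (∑ i, σ (C k i) (h i)) := by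
    simp only [map_sum, LinearMap.sum_apply, preInner_pre, hC, inner_sum, sum_inner,
      sum_apply, map_mul, map_star, mul_apply_eq_comp,
      ContinuousLinearMap.star_eq_adjoint, ContinuousLinearMap.adjoint_inner_right]
    rw [Finset.sum_comm]
    conv_lhs => enter [2, i]; rw [Finset.sum_comm]
    rw [Finset.sum_comm]
    refine Finset.sum_congr rfl fun k _ => Finset.sum_comm
  rw [norm_sq_eq_re_inner (𝕜 := ℂ), inner_eq_preInner, this, map_sum]
  exact Finset.sum_congr rfl fun k _ => (norm_sq_eq_re_inner _).symm

/-- The factor `C` depends only on the `ξ i`, so it serves both norms. Intertwining pulls `X` and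
`Y` out of the sums, and the hypothesis applies to each coordinate in `H^n`. -/
lemma norm_preMap_le {X : H →L[ℂ] H₁} {Y : H →L[ℂ] H₂} (hX : Intertwines σ ρ X)
    (hY : Intertwines σ τ Y) {p : ℝ} (h : ∀ v, p * ‖X v‖ ^ 2 ≤ ‖Y v‖ ^ 2) (x : PreTensor E σ) :
    p * ‖preMap E σ ρ X x‖ ^ 2 ≤ ‖preMap E σ τ Y x‖ ^ 2 := by
  obtain ⟨n, ξ, v, rfl⟩ := exists_sum_pre x
  obtain ⟨C, hC⟩ := exists_gram_eq (M := M) ξ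
  simp only [map_sum, preMap_pre, norm_sum_pre_sq ξ _ C hC, ← hX _ _, ← hY _ _]
  simp only [← map_sum, Finset.mul_sum]
  exact Finset.sum_le_sum fun k _ => h _

lemma norm_preMap_le_opNorm {X : H →L[ℂ] H₁} (hX : Intertwines σ ρ X) (x : PreTensor E σ) :
    ‖preMap E σ ρ X x‖ ≤ ‖X‖ * ‖x‖ := by
  refine le_of_sq_le_sq ?_ (by positivity)
  have h := norm_preMap_le (E := E) (hX) (Intertwines.id.smul (‖X‖ : ℂ)) (p := 1) (fun v => by
    simp only [one_mul, _root_.smul_apply, ContinuousLinearMap.id_apply, norm_smul,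
      Complex.norm_real, norm_norm]
    exact pow_le_pow_left₀ (norm_nonneg _) (X.le_opNorm v) 2) x
  have h2 : preMap E σ σ ((‖X‖ : ℂ) • .id ℂ H) x = (‖X‖ : ℂ) • x :=
    LinearMap.congr_fun (pre_ext (f := preMap E σ σ ((‖X‖ : ℂ) • .id ℂ H))
      (g := (‖X‖ : ℂ) • LinearMap.id) fun ξ k => by
        rw [preMap_pre, LinearMap.smul_apply]
        exact TensorProduct.tmul_smul (‖X‖ : ℂ) ξ k) x
  rw [h2, norm_smul, Complex.norm_real, norm_norm, one_mul] at h
  exact h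

/-- Intertwining supplies the norm bound under which `extendOfNorm` is a genuine extension. -/
lemma idTensor_coe {X : H →L[ℂ] H₁} (hX : Intertwines σ ρ X) (x : PreTensor E σ) :
    idTensor E σ ρ X (toITensor E σ x) = toITensor E ρ (preMap E σ ρ X x) :=
  LinearMap.extendOfNorm_eq (denseRange_toITensor E σ)
    ⟨‖X‖, fun x => by
      have h := norm_preMap_le_opNorm (E := E) hX x
      rw [← UniformSpace.Completion.norm_coe (preMap E σ ρ X x),
        ← UniformSpace.Completion.norm_coe x] at h
      exact h⟩ x

lemma idTensor_tmul {X : H →L[ℂ] H₁} (hX : Intertwines σ ρ X) (ξ : E) (h : H) :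
    idTensor E σ ρ X (tmul E σ ξ h) = tmul E ρ ξ (X h) :=
  idTensor_coe hX _

lemma idTensor_id : idTensor E σ σ (.id ℂ H) = .id ℂ (ITensor E σ) :=
  ITensor.ext_clm fun ξ h => idTensor_tmul Intertwines.id ξ h

lemma norm_idTensor_le {X : H →L[ℂ] H₁} {Y : H →L[ℂ] H₂} (hX : Intertwines σ ρ X)
    (hY : Intertwines σ τ Y) {p : ℝ} (h : ∀ v, p * ‖X v‖ ^ 2 ≤ ‖Y v‖ ^ 2) (x : ITensor E σ) :
    p * ‖idTensor E σ ρ X x‖ ^ 2 ≤ ‖idTensor E σ τ Y x‖ ^ 2 := by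
  induction x using UniformSpace.Completion.induction_on with
  | hp => exact isClosed_le (by fun_prop) (by fun_prop)
  | ih x =>
    have h1 := idTensor_coe (E := E) hX x
    have h2 := idTensor_coe (E := E) hY x
    have h3 := norm_preMap_le hX hY h x
    simp only [LinearIsometry.coe_toLinearMap, UniformSpace.Completion.coe_toComplₗᵢ] at h1 h2
    rw [h1, h2]
    simpa using h3

lemma tmul_add_left (ξ ζ : E) (h : H) : tmul E σ (ξ + ζ) h = tmul E σ ξ h + tmul E σ ζ h :=
  (congrArg (toITensor E σ) (TensorProduct.add_tmul ξ ζ h)).trans (map_add (toITensor E σ) _ _)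

lemma tmul_add_right (ξ : E) (h k : H) : tmul E σ ξ (h + k) = tmul E σ ξ h + tmul E σ ξ k :=
  (congrArg (toITensor E σ) (TensorProduct.tmul_add ξ h k)).trans (map_add (toITensor E σ) _ _)

lemma tmul_smul_left (c : ℂ) (ξ : E) (h : H) : tmul E σ (c • ξ) h = c • tmul E σ ξ h :=
  (congrArg (toITensor E σ) (TensorProduct.smul_tmul' c ξ h).symm).trans
    (map_smul (toITensor E σ) c (pre E σ ξ h))

lemma tmul_smul_right (c : ℂ) (ξ : E) (h : H) : tmul E σ ξ (c • h) = c • tmul E σ ξ h :=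
  (congrArg (toITensor E σ) (TensorProduct.tmul_smul c ξ h)).trans
    (map_smul (toITensor E σ) c (pre E σ ξ h))

lemma norm_rep_le (a : M) : ‖σ a‖ ≤ ‖a‖ := NonUnitalStarAlgHom.norm_apply_le σ a

lemma norm_mip_self (ξ : E) : ‖mip M ξ ξ‖ = ‖ξ‖ ^ 2 := by
  rw [CStarModule.norm_eq_sqrt_norm_inner_self (A := Mᵐᵒᵖ) ξ, Real.sq_sqrt (norm_nonneg _)]
  rfl

lemma norm_tmul_le (ξ : E) (h : H) : ‖tmul E σ ξ h‖ ≤ ‖ξ‖ * ‖h‖ := by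
  refine le_of_sq_le_sq ?_ (by positivity)
  rw [norm_sq_eq_re_inner (𝕜 := ℂ), inner_tmul]
  calc _ ≤ ‖inner ℂ h (σ (mip M ξ ξ) h)‖ := RCLike.re_le_norm _
    _ ≤ ‖h‖ * (‖ξ‖ ^ 2 * ‖h‖) := (norm_inner_le_norm _ _).trans (by
      gcongr
      refine (ContinuousLinearMap.le_opNorm _ _).trans ?_
      gcongr
      rw [← norm_mip_self (M := M)]
      exact norm_rep_le _)
    _ = _ := by ring

variable (E σ) in
/-- The elementary tensors as a continuous bilinear map. -/
def tmulL : E →L[ℂ] H →L[ℂ] ITensor E σ :=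
  LinearMap.mkContinuous₂ (LinearMap.mk₂ ℂ (tmul E σ) tmul_add_left tmul_smul_left
    tmul_add_right tmul_smul_right) 1 fun ξ h => by simpa using norm_tmul_le ξ h

@[simp] lemma tmulL_apply (ξ : E) (h : H) : tmulL E σ ξ h = tmul E σ ξ h := rfl

variable (σ) in
/-- The annihilation operator `ζ ⊗ h ↦ σ(⟨ξ, ζ⟩) h`, the adjoint of `h ↦ ξ ⊗ h`. -/
def annih (ξ : E) : ITensor E σ →L[ℂ] H := ContinuousLinearMap.adjoint (tmulL E σ ξ)

lemma inner_annih_left (ξ : E) (x : ITensor E σ) (h : H) :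
    inner ℂ (annih σ ξ x) h = inner ℂ x (tmul E σ ξ h) := by
  rw [annih, ContinuousLinearMap.adjoint_inner_left, tmulL_apply]

lemma inner_annih_right (ξ : E) (x : ITensor E σ) (h : H) :
    inner ℂ h (annih σ ξ x) = inner ℂ (tmul E σ ξ h) x := by
  rw [annih, ContinuousLinearMap.adjoint_inner_right, tmulL_apply]

lemma annih_tmul (ξ ζ : E) (h : H) : annih σ ξ (tmul E σ ζ h) = σ (mip M ξ ζ) h :=
  ext_inner_left ℂ fun v => by rw [inner_annih_right, inner_tmul]

/-- With `ext_annih`, this lets identities in `E ⊗ H` be checked on the coefficients `annih σ ξ x ∈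
H`. -/
lemma annih_idTensor {X : H →L[ℂ] H₁} (hX : Intertwines σ ρ X) (ξ : E) (x : ITensor E σ) :
    annih ρ ξ (idTensor E σ ρ X x) = X (annih σ ξ x) :=
  DFunLike.congr_fun (ITensor.ext_clm (f := annih ρ ξ ∘L idTensor E σ ρ X) (g := X ∘L annih σ ξ)
    fun ζ h => by simp [idTensor_tmul hX, annih_tmul, hX _ _]) x

lemma ext_annih {x y : ITensor E σ} (h : ∀ ξ, annih σ ξ x = annih σ ξ y) : x = y := by
  refine ext_inner_left ℂ fun v => ?_
  have : innerSL ℂ x = innerSL ℂ y := ITensor.ext_clm fun ξ k => by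
    simp only [innerSL_apply_apply, ← inner_annih_left, h]
  have := DFunLike.congr_fun this v
  simp only [innerSL_apply_apply] at this
  rw [← inner_conj_symm, this, inner_conj_symm]

lemma idTensor_adjoint {X : H →L[ℂ] H₁} (hX : Intertwines σ ρ X) :
    ContinuousLinearMap.adjoint (idTensor E σ ρ X) =
      idTensor E ρ σ (ContinuousLinearMap.adjoint X) := by
  ext x
  refine ext_annih fun ξ => ext_inner_left ℂ fun v => ?_
  rw [annih_idTensor hX.adjoint, ContinuousLinearMap.adjoint_inner_right, inner_annih_right,
    inner_annih_right, ContinuousLinearMap.adjoint_inner_right, idTensor_tmul hX]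

lemma leftRep_tmul (a : M) (ξ : E) (h : H) :
    leftRep E σ a (tmul E σ ξ h) = tmul E σ (CStarCorrespondence.φ a ξ) h := leftCLM_tmul E σ a ξ h

lemma Intertwines.idTensor {X : H →L[ℂ] H₁} (hX : Intertwines σ ρ X) :
    Intertwines (leftRep E σ) (leftRep E ρ) (idTensor E σ ρ X) := fun a x =>
  DFunLike.congr_fun (ITensor.ext_clm (f := CStarCorr.idTensor E σ ρ X ∘L leftRep E σ a)
    (g := leftRep E ρ a ∘L CStarCorr.idTensor E σ ρ X)
    fun ζ h => by simp [idTensor_tmul hX, leftRep_tmul]) x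

lemma eq_zero_of_leftRep_mip (hE : InnerIdealEssential M E) {x : ITensor E σ}
    (hx : ∀ ξ ζ : E, leftRep E σ (mip M ξ ζ) x = 0) : x = 0 := by
  refine ext_annih fun η => ext_inner_left ℂ fun v => ?_
  rw [map_zero, inner_zero_right, inner_annih_right]
  have h1 : Submodule.span ℂ {ω : E | ∃ ξ ζ η : E, ω = CStarCorrespondence.φ (mip M ξ ζ) η} ≤
      ((innerSL ℂ x).comp ((tmulL E σ).flip v)).toLinearMap.ker := by
    rw [Submodule.span_le]
    rintro _ ⟨ξ, ζ, η, rfl⟩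
    simp only [SetLike.mem_coe, LinearMap.mem_ker, ContinuousLinearMap.coe_coe,
      ContinuousLinearMap.comp_apply, ContinuousLinearMap.flip_apply, tmulL_apply,
      innerSL_apply_apply]
    rw [← leftRep_tmul, ← star_star (mip M ξ ζ), ← inner_rep_left, star_mip, hx, inner_zero_left]
  have h2 : η ∈ closure (Submodule.span ℂ
      {ω : E | ∃ ξ ζ η : E, ω = CStarCorrespondence.φ (mip M ξ ζ) η} : Set E) := by
    rw [hE]; trivial
  have h3 := closure_minimal h1 (ContinuousLinearMap.isClosed_ker _) h2
  simp only [SetLike.mem_coe, LinearMap.mem_ker, ContinuousLinearMap.coe_coe,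
      ContinuousLinearMap.comp_apply, ContinuousLinearMap.flip_apply, tmulL_apply,
      innerSL_apply_apply] at h3
  rw [← inner_conj_symm, h3, map_zero]

/-- A vector `x` orthogonal to these coefficients has `ζ ⊗ x = 0` for every `ζ`; applying `annih` at
`ξ` gives `(φ(⟨ξ, ζ⟩) ⊗ I) x = 0`, which essentiality excludes unless `x = 0`. -/
lemma span_annih_dense (hE : InnerIdealEssential M E) :
    (Submodule.span ℂ {y : ITensor E σ | ∃ (ξ : E) (w : ITensor E (leftRep E σ)),
      y = annih (leftRep E σ) ξ w}).topologicalClosure = ⊤ := by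
  rw [Submodule.topologicalClosure_eq_top_iff, Submodule.eq_bot_iff]
  intro x hx
  have h (ξ : E) : tmul E (leftRep E σ) ξ x = 0 := by
    refine ext_inner_left ℂ fun w => ?_
    rw [← inner_annih_left, inner_zero_right]
    exact (Submodule.mem_orthogonal _ _).mp hx _ (Submodule.subset_span ⟨ξ, w, rfl⟩)
  refine eq_zero_of_leftRep_mip hE fun ξ ζ => ?_
  rw [← annih_tmul, h, map_zero]

/-- If `I_E ⊗ D ≥ 0` for a `D` in the commutant of the left action on `E ⊗_σ H`, then `D ≥ 0`. -/
lemma re_inner_nonneg_of_idTensor_isPositive (hE : InnerIdealEssential M E)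
    {D : ITensor E σ →L[ℂ] ITensor E σ} (hD : Intertwines (leftRep E σ) (leftRep E σ) D)
    (hpos : (idTensor E (leftRep E σ) (leftRep E σ) D).IsPositive) (x : ITensor E σ) :
    0 ≤ RCLike.re (inner ℂ x (D x)) := by
  have hx : x ∈ (Submodule.span ℂ {y : ITensor E σ | ∃ (ξ : E) (w : ITensor E (leftRep E σ)),
      y = annih (leftRep E σ) ξ w}).topologicalClosure := by
    rw [span_annih_dense hE]; trivial
  set D' := idTensor E (leftRep E σ) (leftRep E σ) D with hD'
  have hpos' : 0 ≤ D' := (ContinuousLinearMap.nonneg_iff_isPositive _).mpr hpos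
  -- `D'` commutes with all `ζ' ↦ ξ ⊗ annih ζ ζ'`, hence so does its square root `S`. This rewrites
  -- the form of `D` on combinations of `annih ξ w` as a squared norm of combinations of `annih ξ (S
  -- w)`.
  set S := CFC.sqrt D' with hS
  have hSS : S * S = D' := CFC.sqrt_mul_sqrt_self D' hpos'
  have hSsa : IsSelfAdjoint S := (CFC.sqrt_nonneg D').isSelfAdjoint
  have hcomm (ξ ζ : E) : Commute S (tmulL E (leftRep E σ) ξ ∘L annih (leftRep E σ) ζ) := by
    refine Commute.cfcₙ_nnreal (?_ : Commute D' _) _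
    ext v
    simp [hD', annih_idTensor hD, idTensor_tmul hD]
  have key (ξ ζ : E) (w v : ITensor E (leftRep E σ)) :
      inner ℂ (annih (leftRep E σ) ξ w) (D (annih (leftRep E σ) ζ v)) =
        inner ℂ (annih (leftRep E σ) ξ (S w)) (annih (leftRep E σ) ζ (S v)) := by
    have h1 := DFunLike.congr_fun (hcomm ξ ζ) (S v)
    simp only [mul_apply_eq_comp, ContinuousLinearMap.comp_apply, tmulL_apply] at h1
    rw [← annih_idTensor hD, inner_annih_left, inner_annih_left, ← hD', ← hSS,
      mul_apply_eq_comp, ← h1, ← ContinuousLinearMap.adjoint_inner_left,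
      ← ContinuousLinearMap.star_eq_adjoint, hSsa.star_eq]
  refine closure_minimal ?_ (isClosed_le (f := fun _ : ITensor E σ => (0 : ℝ))
    (g := fun x => RCLike.re (inner ℂ x (D x))) (by fun_prop) (by fun_prop)) hx
  intro y hy
  obtain ⟨n, c, g, rfl⟩ := Submodule.mem_span_set'.mp hy
  choose ξ w hw using fun i => (g i).2
  have h2 : inner ℂ (∑ i, c i • (g i : ITensor E σ)) (D (∑ i, c i • (g i : ITensor E σ))) =
      inner ℂ (∑ i, c i • annih (leftRep E σ) (ξ i) (S (w i)))
        (∑ i, c i • annih (leftRep E σ) (ξ i) (S (w i))) := by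
    simp only [hw, map_sum, map_smul, sum_inner, inner_sum, inner_smul_left, inner_smul_right, key]
  change 0 ≤ RCLike.re _
  rw [h2]
  exact inner_self_nonneg

/-- Apply the positivity criterion to `D = X* X - c`, whose amplification is `(I ⊗ X)* (I ⊗ X) - c`.
-/
lemma le_norm_sq_of_idTensor (hE : InnerIdealEssential M E) {X : ITensor E σ →L[ℂ] H₁}
    (hX : Intertwines (leftRep E σ) ρ X) {c : ℝ}
    (h : ∀ z : ITensor E (leftRep E σ), c * ‖z‖ ^ 2 ≤ ‖idTensor E (leftRep E σ) ρ X z‖ ^ 2)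
    (x : ITensor E σ) : c * ‖x‖ ^ 2 ≤ ‖X x‖ ^ 2 := by
  have hXX := hX.adjoint.comp hX
  have hcI := (Intertwines.id (σ := leftRep E σ)).smul (c : ℂ)
  set D := ContinuousLinearMap.adjoint X ∘L X - (c : ℂ) • .id ℂ _
  have hD : Intertwines (leftRep E σ) (leftRep E σ) D := hXX.sub hcI
  have hDv (v) : D v = ContinuousLinearMap.adjoint X (X v) - (c : ℂ) • v := rfl
  clear_value D
  have h1 : idTensor E (leftRep E σ) (leftRep E σ) D =
      ContinuousLinearMap.adjoint (idTensor E (leftRep E σ) ρ X) ∘L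
        idTensor E (leftRep E σ) ρ X - (c : ℂ) • .id ℂ _ := by
    rw [idTensor_adjoint hX]
    refine ContinuousLinearMap.ext fun z => ext_annih fun ξ => ?_
    simp only [annih_idTensor hD, hDv, _root_.sub_apply, map_sub, _root_.smul_apply, map_smul,
      ContinuousLinearMap.comp_apply, annih_idTensor hX.adjoint, annih_idTensor hX,
      ContinuousLinearMap.id_apply]
  have h2 : (idTensor E (leftRep E σ) (leftRep E σ) D).IsPositive := by
    rw [h1, ContinuousLinearMap.isPositive_iff_complex]
    intro z
    have h3 : inner ℂ ((ContinuousLinearMap.adjoint (idTensor E (leftRep E σ) ρ X) ∘L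
        idTensor E (leftRep E σ) ρ X - (c : ℂ) • .id ℂ _) z) z =
        ((‖idTensor E (leftRep E σ) ρ X z‖ ^ 2 - c * ‖z‖ ^ 2 : ℝ) : ℂ) := by
      simp [inner_sub_left, ContinuousLinearMap.adjoint_inner_left, inner_self_eq_norm_sq_to_K,
        inner_smul_left, -Complex.coe_smul]
    rw [h3]
    refine ⟨by rw [RCLike.re_eq_complex_re, Complex.ofReal_re], ?_⟩
    rw [RCLike.re_eq_complex_re, Complex.ofReal_re, sub_nonneg]
    exact h z
  have h4 := re_inner_nonneg_of_idTensor_isPositive hE hD h2 x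
  have h5 : inner ℂ x (D x) = ((‖X x‖ ^ 2 - c * ‖x‖ ^ 2 : ℝ) : ℂ) := by
    simp [hDv, inner_sub_right, ContinuousLinearMap.adjoint_inner_right,
      inner_self_eq_norm_sq_to_K, inner_smul_right, -Complex.coe_smul]
  rw [h5, RCLike.re_eq_complex_re, Complex.ofReal_re, sub_nonneg] at h4
  exact h4

end Amplification

/-! ### From complete boundedness of `T` to boundedness of `T̃`. -/

section RowBound

/-- The squared norm of a row is that of the diagonal entry of `X X*`. Pairing `y` with itself and
using Cauchy–Schwarz leaves a factor `‖y‖²` to cancel. -/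
lemma norm_sum_apply_sq_le {H : Type*} [NormedAddCommGroup H] [InnerProductSpace ℂ H]
    [CompleteSpace H] {n : ℕ} (X : CStarMatrix (Fin n) (Fin n) (H →L[ℂ] H)) (i : Fin n)
    (h : Fin n → H) : ‖∑ j, X i j (h j)‖ ^ 2 ≤ ‖X‖ ^ 2 * ∑ j, ‖h j‖ ^ 2 := by
  set y := ∑ j, X i j (h j) with hy
  have h1 : ‖∑ j, X i j * star (X i j)‖ ≤ ‖X‖ ^ 2 := by
    have := CStarMatrix.norm_entry_le_norm (M := X * star X) (i := i) (j := i)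
    have h0 : ‖X * star X‖ = ‖X‖ * ‖X‖ := CStarRing.norm_self_mul_star
    rw [h0, ← pow_two, CStarMatrix.mul_apply] at this
    exact this
  have h2 : ∑ j, ‖star (X i j) y‖ ^ 2 ≤ ‖X‖ ^ 2 * ‖y‖ ^ 2 := by
    have h3 : ((∑ j, ‖star (X i j) y‖ ^ 2 : ℝ) : ℂ) =
        inner ℂ y ((∑ j, X i j * star (X i j)) y) := by
      simp only [sum_apply, inner_sum, mul_apply_eq_comp, Complex.ofReal_sum]
      refine Finset.sum_congr rfl fun j _ => ?_
      rw [← ContinuousLinearMap.adjoint_inner_left, ← ContinuousLinearMap.star_eq_adjoint,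
        inner_self_eq_norm_sq_to_K]
      simp
    calc _ = ‖((∑ j, ‖star (X i j) y‖ ^ 2 : ℝ) : ℂ)‖ := by
          rw [Complex.norm_real, Real.norm_of_nonneg (by positivity)]
      _ ≤ ‖y‖ * (‖X‖ ^ 2 * ‖y‖) := by
          rw [h3]
          refine (norm_inner_le_norm _ _).trans ?_
          gcongr
          exact (ContinuousLinearMap.le_opNorm _ _).trans (by gcongr)
      _ = _ := by ring
  have h4 : ‖y‖ ^ 2 ≤ ∑ j, ‖star (X i j) y‖ * ‖h j‖ := by
    rw [norm_sq_eq_re_inner (𝕜 := ℂ)]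
    nth_rw 2 [hy]
    rw [inner_sum, map_sum]
    refine Finset.sum_le_sum fun j _ => ?_
    rw [← ContinuousLinearMap.adjoint_inner_left, ← ContinuousLinearMap.star_eq_adjoint]
    exact (RCLike.re_le_norm _).trans (norm_inner_le_norm _ _)
  have h5 := Finset.sum_mul_sq_le_sq_mul_sq Finset.univ (fun j => ‖star (X i j) y‖)
    (fun j => ‖h j‖)
  have h6 : (0 : ℝ) ≤ ∑ j, ‖h j‖ ^ 2 := by positivity
  have h7 : ‖y‖ ^ 2 * ‖y‖ ^ 2 ≤ (‖X‖ ^ 2 * ∑ j, ‖h j‖ ^ 2) * ‖y‖ ^ 2 :=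
    calc _ ≤ (∑ j, ‖star (X i j) y‖ * ‖h j‖) ^ 2 := by
          rw [← pow_two]; exact pow_le_pow_left₀ (by positivity) h4 2
      _ ≤ _ := h5
      _ ≤ (‖X‖ ^ 2 * ‖y‖ ^ 2) * ∑ j, ‖h j‖ ^ 2 := by gcongr
      _ = _ := by ring
  rcases (sq_nonneg ‖y‖).eq_or_lt with h0 | h0
  · rw [← h0]; positivity
  · exact le_of_mul_le_mul_right h7 h0

variable {M E H : Type*} [NonUnitalCStarAlgebra M] [PartialOrder M] [StarOrderedRing M]
  [NormedAddCommGroup E] [NormedSpace ℂ E] [CompleteSpace E] [SMul Mᵐᵒᵖ E] [CStarModule Mᵐᵒᵖ E]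
  [CStarCorrespondence M E]
  [NormedAddCommGroup H] [InnerProductSpace ℂ H] [CompleteSpace H]

variable (M) in
/-- The Gram matrix `(⟨ξ i, ξ j⟩)`. -/
def gram {n : ℕ} (ξ : Fin n → E) : CStarMatrix (Fin n) (Fin n) M :=
  CStarMatrix.ofMatrix fun i j => mip M (ξ i) (ξ j)

lemma gram_apply {n : ℕ} (ξ : Fin n → E) (i j : Fin n) : gram M ξ i j = mip M (ξ i) (ξ j) := rfl

lemma gram_nonneg {n : ℕ} (ξ : Fin n → E) : 0 ≤ gram M ξ := by
  obtain ⟨C, hC⟩ := exists_gram_eq (M := M) ξ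
  have h : gram M ξ = star (CStarMatrix.ofMatrix fun i j => C i j) *
      (CStarMatrix.ofMatrix fun i j => C i j) := by
    ext i j
    rw [gram_apply, hC, CStarMatrix.mul_apply]
    rfl
  rw [h]
  exact star_mul_self_nonneg _

/-- The row `ξ g` for a row `ξ` over `E` and a matrix `g` over `M`. -/
def rowMul {n : ℕ} (ξ : Fin n → E) (g : CStarMatrix (Fin n) (Fin n) M) (j : Fin n) : E :=
  ∑ i, MulOpposite.op (g i j) • ξ i

lemma mip_rowMul_right {n : ℕ} (ξ : Fin n → E) (g : CStarMatrix (Fin n) (Fin n) M) (ζ : E)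
    (j : Fin n) : mip M ζ (rowMul ξ g j) = ∑ i, mip M ζ (ξ i) * g i j := by
  simp only [rowMul, mip_sum_right, mip_act_right]

lemma mip_rowMul_left {n : ℕ} (ξ : Fin n → E) (g : CStarMatrix (Fin n) (Fin n) M) (ζ : E)
    (j : Fin n) : mip M (rowMul ξ g j) ζ = ∑ i, star (g i j) * mip M (ξ i) ζ := by
  simp only [rowMul, mip_sum_left, mip_act_left]

lemma gram_rowMul {n : ℕ} (ξ : Fin n → E) (g : CStarMatrix (Fin n) (Fin n) M) :
    gram M (rowMul ξ g) = star g * gram M ξ * g := by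
  ext i j
  simp only [gram_apply, mip_rowMul_right, mip_rowMul_left, CStarMatrix.mul_apply,
    CStarMatrix.star_apply]

lemma gram_sub_rowMul {n : ℕ} (ξ : Fin n → E) (u : CStarMatrix (Fin n) (Fin n) M) :
    gram M (fun j => ξ j - rowMul ξ u j) =
      gram M ξ - gram M ξ * u - star u * gram M ξ + star u * gram M ξ * u := by
  ext i j
  have h1 (x y z : E) : mip M x (y - z) = mip M x y - mip M x z := map_sub (mipₗ M x) y z
  have h2 (x y z : E) : mip M (x - y) z = mip M x z - mip M y z :=
    LinearMap.map_sub₂ (mipₗ M (E := E)) x y z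
  simp only [gram_apply, h1, h2, mip_rowMul_right, mip_rowMul_left, CStarMatrix.mul_apply,
    CStarMatrix.star_apply, CStarMatrix.sub_apply, CStarMatrix.add_apply]
  abel

namespace CovRep

variable (R : CovRep M E H)

lemma sum_T_rowMul {n : ℕ} (ξ : Fin n → E) (g : CStarMatrix (Fin n) (Fin n) M) (h : Fin n → H) :
    ∑ j, R.T (rowMul ξ g j) (h j) = ∑ i, R.T (ξ i) (∑ j, R.σ (g i j) (h j)) := by
  simp only [rowMul, map_sum, R.map_right, sum_apply, ContinuousLinearMap.comp_apply]
  exact Finset.sum_comm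

lemma sum_T_rowMul_mul {n : ℕ} (ξ : Fin n → E) (g k : CStarMatrix (Fin n) (Fin n) M)
    (h : Fin n → H) :
    ∑ j, R.T (rowMul ξ (g * k) j) (h j) =
      ∑ i, R.T (rowMul ξ g i) (∑ j, R.σ (k i j) (h j)) := by
  rw [sum_T_rowMul, sum_T_rowMul]
  simp only [CStarMatrix.mul_apply, map_sum, map_mul, sum_apply, mul_apply_eq_comp]
  exact Finset.sum_congr rfl fun i _ => Finset.sum_comm

variable {R}

lemma IsCompletelyBounded.exists_row_bound (hcb : R.IsCompletelyBounded) :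
    ∃ C : ℝ, 0 ≤ C ∧ ∀ (n : ℕ) (ξ : Fin n → E) (h : Fin n → H),
      ‖∑ j, R.T (ξ j) (h j)‖ ^ 2 ≤ C ^ 2 * ‖gram M ξ‖ * ∑ j, ‖h j‖ ^ 2 := by
  obtain ⟨C, hC⟩ := hcb
  refine ⟨|C|, abs_nonneg C, fun n ξ h => ?_⟩
  rcases n with - | n
  · simp
  -- With `ξ` as the only nonzero row, the matrix inside the norm on `M_n(E)` is exactly `gram M ξ`.
  have h1 := hC (n + 1) fun i j => if i = 0 then ξ j else 0
  have h0 (x : E) : mip M 0 x = 0 := LinearMap.map_zero₂ (mipₗ M (E := E)) x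
  have h2 : (CStarMatrix.ofMatrix fun i j => ∑ k : Fin (n + 1),
      mip M (if k = 0 then ξ i else 0) (if k = 0 then ξ j else 0) :
      CStarMatrix (Fin (n + 1)) (Fin (n + 1)) M) = gram M ξ := by
    ext i j
    change ∑ k : Fin (n + 1), mip M (if k = 0 then ξ i else 0) (if k = 0 then ξ j else 0) =
      mip M (ξ i) (ξ j)
    rw [Finset.sum_eq_single 0 (fun k _ hk => by simp [hk, h0]) (by simp)]
    simp
  rw [h2] at h1
  refine (norm_sum_apply_sq_le (CStarMatrix.ofMatrix fun i j : Fin (n + 1) =>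
    R.T (if i = 0 then ξ j else 0)) 0 h).trans ?_
  gcongr
  calc _ ≤ (C * √‖gram M ξ‖) ^ 2 := pow_le_pow_left₀ (norm_nonneg _) h1 2
    _ = _ := by rw [mul_pow, Real.sq_sqrt (norm_nonneg _), sq_abs]

end CovRep

/-! ### Approximate factorization through the square root of a positive element. -/

section FunctionalCalculus

variable {A : Type*} [NonUnitalCStarAlgebra A] [PartialOrder A] [StarOrderedRing A]

/-- Here `k = √G`, and `g = √G / (G + δ²)` is a regularized inverse of `k`, as `G` need not be
invertible. The remainder is the function `t (1 - t / (t + δ²))²`, bounded by `δ²`. -/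
lemma exists_approx_sqrt_factor (G : A) (hG : 0 ≤ G) {δ : ℝ} (hδ : 0 < δ) :
    ∃ g k : A, star k * k = G ∧ ‖star g * G * g‖ ≤ 1 ∧
      ‖G - G * (g * k) - star (g * k) * G + star (g * k) * G * (g * k)‖ ≤ δ ^ 2 := by
  have hsa : IsSelfAdjoint G := hG.isSelfAdjoint
  have hsp : ∀ t ∈ quasispectrum ℝ G, 0 ≤ t := fun t ht => quasispectrum_nonneg_of_nonneg G hG t ht
  -- The absolute value makes the functions continuous on all of `ℝ`; on the quasispectrum it is
  -- just `t`.
  have hne (t : ℝ) : |t| + δ ^ 2 ≠ 0 := by positivity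
  have hcg : Continuous fun t : ℝ => √t / (|t| + δ ^ 2) := by fun_prop (disch := exact hne _)
  have hcu : Continuous fun t : ℝ => √t / (|t| + δ ^ 2) * √t := by fun_prop (disch := exact hne _)
  set g := cfcₙ (fun t : ℝ => √t / (|t| + δ ^ 2)) G with hg
  set k := cfcₙ (fun t : ℝ => √t) G with hk
  have hgs : star g = g := (cfcₙ_predicate _ _ : IsSelfAdjoint g)
  have hks : star k = k := (cfcₙ_predicate _ _ : IsSelfAdjoint k)
  have hid : cfcₙ (fun t : ℝ => t) G = G := cfcₙ_id' ℝ G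
  have hu : g * k = cfcₙ (fun t : ℝ => √t / (|t| + δ ^ 2) * √t) G :=
    (cfcₙ_mul _ _ G hcg.continuousOn (by simp) (by fun_prop) (by simp)).symm
  have hus : star (g * k) = g * k := by
    change IsSelfAdjoint (g * k)
    rw [hu]
    exact cfcₙ_predicate _ _
  refine ⟨g, k, ?_, ?_, ?_⟩
  · rw [hks, hk, ← cfcₙ_mul _ _ G (by fun_prop) (by simp) (by fun_prop) (by simp)]
    conv_rhs => rw [← hid]
    exact cfcₙ_congr fun t ht => Real.mul_self_sqrt (hsp t ht)
  · have h1 : star g * G * g =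
        cfcₙ (fun t : ℝ => √t / (|t| + δ ^ 2) * t * (√t / (|t| + δ ^ 2))) G := by
      rw [hgs]
      nth_rw 1 [← hid]
      rw [hg, ← cfcₙ_mul _ _ G hcg.continuousOn (by simp) (by fun_prop) (by simp),
        ← cfcₙ_mul _ _ G (by fun_prop (disch := exact hne _)) (by simp) hcg.continuousOn (by simp)]
    rw [h1]
    refine norm_cfcₙ_le fun t ht => ?_
    have ht0 := hsp t ht
    have h2 : √t / (|t| + δ ^ 2) * t * (√t / (|t| + δ ^ 2)) = (t / (t + δ ^ 2)) ^ 2 := by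
      rw [abs_of_nonneg ht0]
      have := Real.mul_self_sqrt ht0
      field_simp
      nlinarith
    rw [h2, Real.norm_of_nonneg (by positivity)]
    exact pow_le_one₀ (by positivity) ((div_le_one (by positivity)).mpr (by nlinarith))
  · rw [hus, hu]
    set f : ℝ → ℝ := fun t => √t / (|t| + δ ^ 2) * √t with hf
    have hf0 : f 0 = 0 := by simp [hf]
    have h1 : G - G * cfcₙ f G - cfcₙ f G * G + cfcₙ f G * G * cfcₙ f G =
        cfcₙ (fun t => t - t * f t - f t * t + f t * t * f t) G := by
      have e1 : G * cfcₙ f G = cfcₙ (fun t => t * f t) G := by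
        nth_rw 1 [← hid]
        exact (cfcₙ_mul _ _ G (by fun_prop) (by simp) hcu.continuousOn hf0).symm
      have e2 : cfcₙ f G * G = cfcₙ (fun t => f t * t) G := by
        nth_rw 2 [← hid]
        exact (cfcₙ_mul _ _ G hcu.continuousOn hf0 (by fun_prop) (by simp)).symm
      have e3 : cfcₙ f G * G * cfcₙ f G = cfcₙ (fun t => f t * t * f t) G := by
        rw [e2]
        exact (cfcₙ_mul _ _ G (by fun_prop) (by simp) hcu.continuousOn hf0).symm
      rw [e3, e2, e1]
      nth_rw 1 [← hid]
      rw [← cfcₙ_sub _ _ G (by fun_prop) (by simp) (by fun_prop) (by simp),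
        ← cfcₙ_sub _ _ G (by fun_prop) (by simp) (by fun_prop) (by simp),
        ← cfcₙ_add _ _ _ (by fun_prop) (by simp) (by fun_prop) (by simp)]
    rw [h1]
    refine norm_cfcₙ_le fun t ht => ?_
    have ht0 := hsp t ht
    have h2 : f t = t / (t + δ ^ 2) := by
      simp only [hf]
      rw [abs_of_nonneg ht0, div_mul_eq_mul_div, Real.mul_self_sqrt ht0]
    have h3 : t - t * f t - f t * t + f t * t * f t =
        δ ^ 2 * ((t / (t + δ ^ 2)) * (δ ^ 2 / (t + δ ^ 2))) := by
      rw [h2]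
      field_simp
      ring
    rw [h3, Real.norm_of_nonneg (by positivity)]
    refine mul_le_of_le_one_right (by positivity) (mul_le_one₀ ?_ (by positivity) ?_)
    · exact (div_le_one (by positivity)).mpr (by nlinarith)
    · exact (div_le_one (by positivity)).mpr (by nlinarith)

end FunctionalCalculus

/-! ### Boundedness of `T̃`. -/

namespace CovRep

variable {R : CovRep M E H}

lemma preTilde_pre (ξ : E) (h : H) : R.preTilde (pre E R.σ ξ h) = R.T ξ h := rfl

/-- A completely bounded covariant representation induces a bounded operator on `E ⊗_σ H`. -/
lemma IsCompletelyBounded.exists_norm_preTilde_le (hcb : R.IsCompletelyBounded) :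
    ∃ C : ℝ, ∀ x, ‖R.preTilde x‖ ≤ C * ‖x‖ := by
  obtain ⟨C, hC0, hC⟩ := hcb.exists_row_bound
  refine ⟨C, fun x => ?_⟩
  obtain ⟨n, ξ, h, rfl⟩ := exists_sum_pre x
  set x := ∑ i, pre E R.σ (ξ i) (h i) with hx
  set B := √(∑ j, ‖h j‖ ^ 2)
  have hB : B ^ 2 = ∑ j, ‖h j‖ ^ 2 := Real.sq_sqrt (by positivity)
  -- The row bound alone controls by `‖gram‖ · ∑ ‖h j‖²`, which may far exceed `‖x‖²`. So split `ξ =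
  -- ξ g k + (ξ - ξ g k)`: the row `ξ g` has Gram norm at most `1` and `k` applied to `h` has norm
  -- `‖x‖`, while the remainder has Gram norm at most `δ²`.
  have key : ∀ δ : ℝ, 0 < δ → ‖R.preTilde x‖ ≤ C * δ * B + C * ‖x‖ := by
    intro δ hδ
    obtain ⟨g, k, hk, hg, hd⟩ := exists_approx_sqrt_factor (gram M ξ) (gram_nonneg ξ) hδ
    have h1 : R.preTilde x = ∑ j, R.T (ξ j - rowMul ξ (g * k) j) (h j) +
        ∑ i, R.T (rowMul ξ g i) (∑ j, R.σ (k i j) (h j)) := by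
      rw [← sum_T_rowMul_mul, ← Finset.sum_add_distrib, hx, map_sum]
      exact Finset.sum_congr rfl fun j _ => by simp [preTilde_pre]
    have h2 : ‖∑ j, R.T (ξ j - rowMul ξ (g * k) j) (h j)‖ ≤ C * δ * B := by
      refine le_of_sq_le_sq ((hC n _ h).trans ?_) (by positivity)
      rw [gram_sub_rowMul, mul_pow, mul_pow, hB]
      gcongr
    have h3 : ‖∑ i, R.T (rowMul ξ g i) (∑ j, R.σ (k i j) (h j))‖ ≤ C * ‖x‖ := by
      refine le_of_sq_le_sq ((hC n _ _).trans ?_) (by positivity)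
      have h4 := norm_sum_pre_sq (σ := R.σ) ξ h (fun i j => k i j) fun i j => by
        rw [← gram_apply, ← hk, CStarMatrix.mul_apply]; rfl
      rw [← h4, gram_rowMul, mul_pow]
      gcongr
      exact mul_le_of_le_one_right (by positivity) hg
    rw [h1]
    exact (norm_add_le _ _).trans (add_le_add h2 h3)
  have hlim : Filter.Tendsto (fun δ : ℝ => C * δ * B + C * ‖x‖) (nhdsWithin 0 (Set.Ioi 0))
      (nhds (C * 0 * B + C * ‖x‖)) :=
    ((by fun_prop : Continuous fun δ : ℝ => C * δ * B + C * ‖x‖).tendsto 0).mono_left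
      nhdsWithin_le_nhds
  rw [mul_zero, zero_mul, zero_add] at hlim
  exact ge_of_tendsto hlim (Filter.eventually_of_mem self_mem_nhdsWithin key)

lemma tilde_tmul (hcb : R.IsCompletelyBounded) (ξ : E) (h : H) :
    R.tilde (tmul E R.σ ξ h) = R.T ξ h := by
  obtain ⟨C, hC⟩ := hcb.exists_norm_preTilde_le
  exact LinearMap.extendOfNorm_eq (denseRange_toITensor E R.σ)
    ⟨C, fun x => by simpa using hC x⟩ (pre E R.σ ξ h)

end CovRep

end RowBound

/-! ### Expansive operators: left inverses, closed ranges, vectors of equal norm. -/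

section LeftInverse

variable {M : Type*} [NonUnitalCStarAlgebra M] [PartialOrder M] [StarOrderedRing M]
  {H H₁ : Type*} [NormedAddCommGroup H] [InnerProductSpace ℂ H] [CompleteSpace H]
  [NormedAddCommGroup H₁] [InnerProductSpace ℂ H₁] [CompleteSpace H₁]
  {σ : M →⋆ₙₐ[ℂ] (H →L[ℂ] H)} {ρ : M →⋆ₙₐ[ℂ] (H₁ →L[ℂ] H₁)}

/-- Expansiveness makes `X* X` invertible; `(X* X)⁻¹ X*` is the left inverse, and it intertwines
because `X* X` commutes with `σ`. -/
lemma Intertwines.exists_leftInverse {X : H →L[ℂ] H₁} (hX : Intertwines σ ρ X)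
    (h : ∀ v, ‖v‖ ^ 2 ≤ ‖X v‖ ^ 2) :
    ∃ G : H₁ →L[ℂ] H, Intertwines ρ σ G ∧ ∀ v, G (X v) = v := by
  have hQ : IsUnit (ContinuousLinearMap.adjoint X ∘L X) := by
    refine ContinuousLinearMap.isUnit_of_forall_le_norm_inner_map _ (c := 1) one_pos fun v => ?_
    rw [ContinuousLinearMap.comp_apply, ContinuousLinearMap.adjoint_inner_left,
      inner_self_eq_norm_sq_to_K]
    simpa using h v
  obtain ⟨u, hu⟩ := hQ
  have hinv (v : H) : (↑u⁻¹ : H →L[ℂ] H) ((u : H →L[ℂ] H) v) = v := by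
    rw [← mul_apply_eq_comp, Units.inv_mul]; rfl
  refine ⟨(↑u⁻¹ : H →L[ℂ] H) ∘L ContinuousLinearMap.adjoint X, Intertwines.comp ?_ hX.adjoint,
    fun v => ?_⟩
  · intro a v
    have h1 : Commute (u : H →L[ℂ] H) (σ a) := by
      rw [hu]
      ext v
      exact (hX.adjoint.comp hX) a v
    exact DFunLike.congr_fun h1.units_inv_left v
  · have h1 := hinv v
    rwa [hu] at h1

lemma apply_leftInverse {X : H →L[ℂ] H₁} {G : H₁ →L[ℂ] H} (hG : ∀ v, G (X v) = v) {w : H₁}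
    (hw : w ∈ X.range) : X (G w) = w := by
  obtain ⟨v, rfl⟩ := hw
  exact congrArg X (hG v)

lemma Intertwines.isClosed_range {X : H →L[ℂ] H₁} (hX : Intertwines σ ρ X)
    (h : ∀ v, ‖v‖ ^ 2 ≤ ‖X v‖ ^ 2) : IsClosed (X.range : Set H₁) := by
  obtain ⟨G, -, hG⟩ := hX.exists_leftInverse h
  have : (X.range : Set H₁) = {w | X (G w) = w} :=
    Set.ext fun w => ⟨fun hw => apply_leftInverse hG hw, fun hw => ⟨G w, hw⟩⟩
  rw [this]
  exact isClosed_eq (by fun_prop) continuous_id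

/-- The positive operator `D = X* X - I` satisfies `⟨D x, x⟩ = 0`, so `√D x = 0` and thus `D x = 0`.
-/
lemma adjoint_apply_of_expansive {X : H →L[ℂ] H₁} (h : ∀ v, ‖v‖ ^ 2 ≤ ‖X v‖ ^ 2) {x : H}
    (hx : ‖X x‖ ^ 2 ≤ ‖x‖ ^ 2) : ContinuousLinearMap.adjoint X (X x) = x := by
  set D := ContinuousLinearMap.adjoint X ∘L X - .id ℂ H
  have hD (v) : D v = ContinuousLinearMap.adjoint X (X v) - v := rfl
  have hinner (v) : inner ℂ (D v) v = ((‖X v‖ ^ 2 - ‖v‖ ^ 2 : ℝ) : ℂ) := by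
    simp [hD, ContinuousLinearMap.adjoint_inner_left, inner_self_eq_norm_sq_to_K]
  have hpos : D.IsPositive := by
    rw [ContinuousLinearMap.isPositive_iff_complex]
    intro v
    rw [hinner]
    refine ⟨by rw [RCLike.re_eq_complex_re, Complex.ofReal_re], ?_⟩
    rw [RCLike.re_eq_complex_re, Complex.ofReal_re, sub_nonneg]
    exact h v
  have hD0 : 0 ≤ D := (ContinuousLinearMap.nonneg_iff_isPositive _).mpr hpos
  set S := CFC.sqrt D
  have hSS : S * S = D := CFC.sqrt_mul_sqrt_self D hD0
  have hS : star S = S := (CFC.sqrt_nonneg D).isSelfAdjoint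
  have h1 : inner ℂ (S x) (S x) = 0 := by
    rw [← hS, ContinuousLinearMap.star_eq_adjoint, ContinuousLinearMap.adjoint_inner_left,
      ← ContinuousLinearMap.star_eq_adjoint, hS, ← mul_apply_eq_comp, hSS, ← inner_conj_symm,
      hinner, le_antisymm hx (h x)]
    simp
  rw [← sub_eq_zero, ← hD, ← hSS, mul_apply_eq_comp, inner_self_eq_zero.mp h1, map_zero]

end LeftInverse

universe u v w

variable {M : Type u} {E : Type v} {H : Type w} [NonUnitalCStarAlgebra M] [PartialOrder M]
  [StarOrderedRing M] [NormedAddCommGroup E] [NormedSpace ℂ E] [CompleteSpace E] [SMul Mᵐᵒᵖ E]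
  [CStarModule Mᵐᵒᵖ E] [CStarCorrespondence M E]
  [NormedAddCommGroup H] [InnerProductSpace ℂ H] [CompleteSpace H]

lemma le_of_forall_nat_div_mul_le {a b : ℝ} (h : ∀ n : ℕ, (n / (n + 1) : ℝ) * a ≤ b) : a ≤ b := by
  have := (tendsto_natCast_div_add_atTop (1 : ℝ)).mul_const a
  rw [one_mul] at this
  exact le_of_tendsto' this h

namespace CovRep

variable {R : CovRep M E H}

/-! ### Isometric covariant representations. -/

section Isometric

/-- The isometry relation itself bounds `preTilde`, so `tilde` is not the default value `0`;
complete boundedness of the restriction to `H_∞` need not be checked. -/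
lemma IsIsometric.tilde_tmul (hR : R.IsIsometric) (ξ : E) (h : H) :
    R.tilde (tmul E R.σ ξ h) = R.T ξ h := by
  have h1 (x y : PreTensor E R.σ) : inner ℂ (R.preTilde x) (R.preTilde y) = inner ℂ x y := by
    induction x using pre_induction with
    | h0 => simp
    | h2 x x' hx hx' => simp [hx, hx', inner_add_left]
    | h1 ξ h =>
      induction y using pre_induction with
      | h0 => simp
      | h2 y y' hy hy' => simp [hy, hy', inner_add_right]
      | h1 ζ k =>
        rw [preTilde_pre, preTilde_pre, ← ContinuousLinearMap.adjoint_inner_right,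
          ← ContinuousLinearMap.comp_apply, hR]
        rfl
  refine LinearMap.extendOfNorm_eq (denseRange_toITensor E R.σ) ⟨1, fun x => ?_⟩ (pre E R.σ ξ h)
  refine le_of_sq_le_sq (le_of_eq ?_) (by positivity)
  rw [norm_sq_eq_re_inner (𝕜 := ℂ), h1, ← norm_sq_eq_re_inner]
  simp

lemma IsIsometric.adjoint_tilde_tilde (hR : R.IsIsometric) (x : ITensor E R.σ) :
    ContinuousLinearMap.adjoint R.tilde (R.tilde x) = x := by
  refine DFunLike.congr_fun (ITensor.ext_clm
    (f := ContinuousLinearMap.adjoint R.tilde ∘L R.tilde) (g := .id ℂ _) fun ζ k => ?_) x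
  refine ext_annih fun ξ => ext_inner_left ℂ fun v => ?_
  rw [ContinuousLinearMap.comp_apply, inner_annih_right, ContinuousLinearMap.adjoint_inner_right,
    hR.tilde_tmul, hR.tilde_tmul, ← ContinuousLinearMap.adjoint_inner_right,
    ← ContinuousLinearMap.comp_apply, hR, ContinuousLinearMap.id_apply, annih_tmul]

lemma IsIsometric.isFullyCoisometric (hR : R.IsIsometric) (hs : Function.Surjective R.tilde) :
    R.IsFullyCoisometric := by
  ext h
  obtain ⟨x, rfl⟩ := hs h
  rw [ContinuousLinearMap.comp_apply, hR.adjoint_tilde_tilde, ContinuousLinearMap.id_apply]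

end Isometric

/-! ### Concave representations: the two norm estimates and the reducing subspace. -/

section Concave

lemma tilde_intertwines (hcb : R.IsCompletelyBounded) :
    Intertwines (leftRep E R.σ) R.σ R.tilde := fun a x =>
  DFunLike.congr_fun (ITensor.ext_clm (f := R.tilde ∘L leftRep E R.σ a) (g := R.σ a ∘L R.tilde)
    fun ξ h => by simp [leftRep_tmul, tilde_tmul hcb, R.map_left]) x

lemma tildePow_intertwines (hcb : R.IsCompletelyBounded) :
    ∀ n, Intertwines (powTensor E R.σ n).rep R.σ (R.tildePow n)
  | 0 => tilde_intertwines hcb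
  | n + 1 => (tilde_intertwines hcb).comp (tildePow_intertwines hcb n).idTensor

lemma tildePow_succ_apply (n : ℕ) (x : ITensor E (powTensor E R.σ n).rep) :
    R.tildePow (n + 1) x =
      R.tilde (idTensor E (powTensor E R.σ n).rep R.σ (R.tildePow n) x) := rfl

lemma IsConcave.norm_tilde_idTensor_sq_add_le (hconc : R.IsConcave)
    (z : ITensor E (leftRep E R.σ)) :
    ‖R.tilde (idTensor E (leftRep E R.σ) R.σ R.tilde z)‖ ^ 2 + ‖z‖ ^ 2 ≤
      2 * ‖idTensor E (leftRep E R.σ) R.σ R.tilde z‖ ^ 2 := hconc z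

/-- One step of the recursion: `1 / (2 - n / (n + 1)) = (n + 1) / (n + 2)`. -/
lemma div_succ_step (n : ℕ) {a b : ℝ} (h : a ≤ (2 - n / (n + 1)) * b) :
    ((n + 1 : ℕ) / ((n + 1 : ℕ) + 1) : ℝ) * a ≤ b := by
  have h1 : (2 - n / (n + 1) : ℝ) = (n + 2) / (n + 1) := by field_simp; ring
  rw [h1, div_mul_eq_mul_div, le_div_iff₀ (by positivity)] at h
  push_cast
  rw [div_mul_eq_mul_div, div_le_iff₀ (by positivity)]
  linarith

/-- For a concave covariant representation, `T̃` is expansive. -/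
lemma IsConcave.norm_sq_le_tilde (hE : InnerIdealEssential M E) (hcb : R.IsCompletelyBounded)
    (hconc : R.IsConcave) (x : ITensor E R.σ) : ‖x‖ ^ 2 ≤ ‖R.tilde x‖ ^ 2 := by
  refine le_of_forall_nat_div_mul_le fun n => ?_
  induction n generalizing x with
  | zero => simp
  | succ n ih =>
    refine le_norm_sq_of_idTensor hE (tilde_intertwines hcb) (fun z => div_succ_step n ?_) x
    -- The previous bound at `(I ⊗ T̃) z` bounds `‖T̃_2 z‖²` below, and concavity bounds it above.
    have h1 := ih (idTensor E (leftRep E R.σ) R.σ R.tilde z)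
    have h2 := hconc.norm_tilde_idTensor_sq_add_le z
    linarith

lemma IsConcave.norm_sq_le_tildePow (hE : InnerIdealEssential M E) (hcb : R.IsCompletelyBounded)
    (hconc : R.IsConcave) :
    ∀ (n : ℕ) (x : (powTensor E R.σ n).carrier), ‖x‖ ^ 2 ≤ ‖R.tildePow n x‖ ^ 2
  | 0, x => hconc.norm_sq_le_tilde hE hcb x
  | n + 1, x => by
    refine le_trans ?_ (hconc.norm_sq_le_tilde hE hcb _)
    have h := norm_idTensor_le (E := E) (p := 1) Intertwines.id (tildePow_intertwines hcb n)
      (fun v => by simpa using hconc.norm_sq_le_tildePow hE hcb n v) x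
    rwa [idTensor_id, one_mul] at h

lemma mem_Hinf {h : H} : h ∈ R.Hinf ↔ ∀ n, h ∈ (R.tildePow n).range := Submodule.mem_iInf _

lemma mem_range_tilde {h : H} (hh : h ∈ R.Hinf) : h ∈ R.tilde.range := mem_Hinf.mp hh 0

lemma IsConcave.isClosed_Hinf (hE : InnerIdealEssential M E) (hcb : R.IsCompletelyBounded)
    (hconc : R.IsConcave) : IsClosed (R.Hinf : Set H) := by
  rw [Hinf, Submodule.coe_iInf]
  exact isClosed_iInter fun n =>
    (tildePow_intertwines hcb n).isClosed_range (hconc.norm_sq_le_tildePow hE hcb n)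

lemma σ_mem_Hinf (hcb : R.IsCompletelyBounded) (a : M) {h : H} (hh : h ∈ R.Hinf) :
    R.σ a h ∈ R.Hinf := by
  refine mem_Hinf.mpr fun n => ?_
  obtain ⟨x, rfl⟩ := mem_Hinf.mp hh n
  exact ⟨(powTensor E R.σ n).rep a x, tildePow_intertwines hcb n a x⟩

lemma T_mem_Hinf (hcb : R.IsCompletelyBounded) (ξ : E) {h : H} (hh : h ∈ R.Hinf) :
    R.T ξ h ∈ R.Hinf := by
  refine mem_Hinf.mpr fun n => ?_
  rcases n with - | n
  · exact ⟨tmul E R.σ ξ h, tilde_tmul hcb ξ h⟩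
  · obtain ⟨x, rfl⟩ := mem_Hinf.mp hh n
    refine ⟨tmul E (powTensor E R.σ n).rep ξ x, ?_⟩
    refine (tildePow_succ_apply n _).trans ?_
    rw [idTensor_tmul (tildePow_intertwines hcb n), tilde_tmul hcb]
    rfl

/-- This says that `x` lies in `E ⊗ H_∞`. As `T̃` is injective, `T̃ x = T̃ (I ⊗ T̃_{n+1}) y` gives
`x = (I ⊗ T̃_{n+1}) y`, whose coefficients lie in the range of `T̃_{n+1}`, that is of `tildePow n`.
-/
lemma IsConcave.annih_mem_Hinf (hE : InnerIdealEssential M E) (hcb : R.IsCompletelyBounded)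
    (hconc : R.IsConcave) {x : ITensor E R.σ} (hx : R.tilde x ∈ R.Hinf) (ξ : E) :
    annih R.σ ξ x ∈ R.Hinf := by
  refine mem_Hinf.mpr fun n => ?_
  obtain ⟨(y : ITensor E (powTensor E R.σ n).rep), hy⟩ := mem_Hinf.mp hx (n + 1)
  have h1 : idTensor E (powTensor E R.σ n).rep R.σ (R.tildePow n) y = x := by
    obtain ⟨G, -, hG⟩ := (tilde_intertwines hcb).exists_leftInverse (hconc.norm_sq_le_tilde hE hcb)
    rw [← hG x, ← hG (idTensor E (powTensor E R.σ n).rep R.σ (R.tildePow n) y)]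
    exact congrArg G hy
  rw [← h1, annih_idTensor (tildePow_intertwines hcb n)]
  exact ⟨_, rfl⟩

lemma starProjection_intertwines {K : Submodule ℂ H} [K.HasOrthogonalProjection]
    (hK : ∀ a, ∀ h ∈ K, R.σ a h ∈ K) : Intertwines R.σ R.σ K.starProjection := fun a h => by
  refine Submodule.eq_starProjection_of_mem_of_inner_eq_zero
    (hK a _ (Submodule.starProjection_apply_mem _ _)) fun v hv => ?_
  rw [← map_sub, inner_rep_left]
  exact Submodule.starProjection_inner_eq_zero _ _ (hK _ v hv)

lemma IsConcave.norm_tilde_sq_le (hE : InnerIdealEssential M E) (hcb : R.IsCompletelyBounded)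
    (hconc : R.IsConcave) {x : ITensor E R.σ} (hx : R.tilde x ∈ R.Hinf) :
    ‖R.tilde x‖ ^ 2 ≤ ‖x‖ ^ 2 := by
  have : CompleteSpace R.Hinf := (hconc.isClosed_Hinf hE hcb).completeSpace_coe
  obtain ⟨G, hGi, hG⟩ :=
    (tilde_intertwines hcb).exists_leftInverse (hconc.norm_sq_le_tilde hE hcb)
  have hP := starProjection_intertwines fun a h hh => R.σ_mem_Hinf hcb a hh
  have hTG {w : H} (hw : w ∈ R.Hinf) : R.tilde (G w) = w :=
    apply_leftInverse hG (mem_range_tilde hw)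
  refine le_of_forall_nat_div_mul_le fun n => ?_
  induction n generalizing x with
  | zero => simp
  | succ n ih =>
    refine div_succ_step n ?_
    have hann (ξ : E) : R.Hinf.starProjection (annih R.σ ξ x) = annih R.σ ξ x :=
      Submodule.starProjection_eq_self_iff.mpr (hconc.annih_mem_Hinf hE hcb hx ξ)
    have hGP := hGi.comp hP
    -- `G` inverts `T̃` only on its range, so `P` is inserted; it fixes the coefficients of `x`,
    -- whence `(I ⊗ T̃) z = x`.
    set z := idTensor E R.σ (leftRep E R.σ) (G ∘L R.Hinf.starProjection) x with hz
    have h1 : idTensor E (leftRep E R.σ) R.σ R.tilde z = x := by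
      refine ext_annih fun ξ => ?_
      rw [annih_idTensor (tilde_intertwines hcb), hz, annih_idTensor hGP,
        ContinuousLinearMap.comp_apply, hann, hTG (hconc.annih_mem_Hinf hE hcb hx ξ)]
    have h2 : (n / (n + 1) : ℝ) * ‖x‖ ^ 2 ≤ ‖z‖ ^ 2 := by
      have h3 : idTensor E R.σ R.σ R.Hinf.starProjection x = x :=
        ext_annih fun ξ => by rw [annih_idTensor hP, hann]
      -- The induction hypothesis at `G P v` compares `P v` with `G P v`; amplifying compares `x =
      -- (I ⊗ P) x` with `z`.
      have h4 := norm_idTensor_le (E := E) hP hGP (p := n / (n + 1)) (fun v => by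
        have hv : R.Hinf.starProjection v ∈ R.Hinf := Submodule.starProjection_apply_mem _ _
        have := ih (x := G (R.Hinf.starProjection v)) (by rwa [hTG hv])
        rwa [hTG hv] at this) x
      rwa [h3] at h4
    have h5 := hconc.norm_tilde_idTensor_sq_add_le z
    rw [h1] at h5
    linarith

lemma IsConcave.adjoint_tilde_tilde (hE : InnerIdealEssential M E) (hcb : R.IsCompletelyBounded)
    (hconc : R.IsConcave) {x : ITensor E R.σ} (hx : R.tilde x ∈ R.Hinf) :
    ContinuousLinearMap.adjoint R.tilde (R.tilde x) = x :=
  adjoint_apply_of_expansive (hconc.norm_sq_le_tilde hE hcb) (hconc.norm_tilde_sq_le hE hcb hx)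

lemma IsConcave.isReducing_Hinf (hE : InnerIdealEssential M E) (hcb : R.IsCompletelyBounded)
    (hconc : R.IsConcave) : R.IsReducing R.Hinf where
  isClosed := hconc.isClosed_Hinf hE hcb
  σ_mem a _ hh := σ_mem_Hinf hcb a hh
  T_mem ξ _ hh := T_mem_Hinf hcb ξ hh
  T_mem_orthogonal ξ h hh := by
    refine (Submodule.mem_orthogonal' _ _).mpr fun w hw => ?_
    obtain ⟨x, rfl⟩ := mem_range_tilde hw
    rw [ContinuousLinearMap.coe_coe] at hw ⊢
    -- For `w = T̃ x` in `H_∞`: `⟨T(ξ) h, T̃ x⟩ = ⟨ξ ⊗ h, T̃* T̃ x⟩ = ⟨ξ ⊗ h, x⟩ = ⟨h, annih ξ x⟩ =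
    -- 0`.
    rw [← tilde_tmul hcb, ← ContinuousLinearMap.adjoint_inner_right,
      hconc.adjoint_tilde_tilde hE hcb hw, ← inner_annih_right]
    exact (Submodule.mem_orthogonal' _ _).mp hh _ (hconc.annih_mem_Hinf hE hcb hw ξ)

lemma IsConcave.restrict_isIsometric (hE : InnerIdealEssential M E)
    (hcb : R.IsCompletelyBounded) (hconc : R.IsConcave) [CompleteSpace R.Hinf]
    (hred : R.IsReducing R.Hinf) : (R.restrict R.Hinf hred).IsIsometric := by
  intro ξ ζ
  ext k
  refine congrArg Subtype.val (ext_inner_left ℂ fun h => ?_)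
  rw [ContinuousLinearMap.comp_apply, ContinuousLinearMap.adjoint_inner_right]
  change inner ℂ (R.T ξ h) (R.T ζ k) = inner ℂ (h : H) (R.σ (mip M ξ ζ) k)
  have hk : R.tilde (tmul E R.σ ζ k) ∈ R.Hinf := by
    rw [tilde_tmul hcb]
    exact T_mem_Hinf hcb ζ k.2
  rw [← tilde_tmul hcb, ← tilde_tmul hcb, ← ContinuousLinearMap.adjoint_inner_right,
    hconc.adjoint_tilde_tilde hE hcb hk, inner_tmul]

/-- A preimage `x` of `w` under `T̃` has all its coefficients in `H_∞`, so projecting them onto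
`H_∞` loses nothing and gives a preimage in `E ⊗ H_∞`. -/
lemma IsConcave.tilde_restrict_surjective (hE : InnerIdealEssential M E)
    (hcb : R.IsCompletelyBounded) (hconc : R.IsConcave) [CompleteSpace R.Hinf]
    (hred : R.IsReducing R.Hinf) : Function.Surjective (R.restrict R.Hinf hred).tilde := by
  intro w
  set S := R.restrict R.Hinf hred
  have hS : S.IsIsometric := hconc.restrict_isIsometric hE hcb hred
  have hι : Intertwines S.σ R.σ R.Hinf.subtypeL := fun a h => rfl
  have hP : Intertwines R.σ S.σ R.Hinf.orthogonalProjectionOnto := fun a h =>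
    Subtype.ext (starProjection_intertwines (fun a h hh => R.σ_mem_Hinf hcb a hh) a h)
  have hι' (y : ITensor E S.σ) :
      (S.tilde y : H) = R.tilde (idTensor E S.σ R.σ R.Hinf.subtypeL y) :=
    DFunLike.congr_fun (ITensor.ext_clm (f := R.Hinf.subtypeL ∘L S.tilde)
      (g := R.tilde ∘L idTensor E S.σ R.σ R.Hinf.subtypeL) fun ξ h => by
        simp only [ContinuousLinearMap.comp_apply, hS.tilde_tmul, idTensor_tmul hι, tilde_tmul hcb]
        rfl) y
  obtain ⟨x, hx⟩ := mem_range_tilde w.2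
  have hx' : R.tilde x ∈ R.Hinf := by
    have h := w.2
    rwa [← hx] at h
  refine ⟨idTensor E R.σ S.σ R.Hinf.orthogonalProjectionOnto x, Subtype.ext ?_⟩
  rw [hι', ← hx]
  refine congrArg R.tilde (ext_annih fun ξ => ?_)
  rw [annih_idTensor hι, annih_idTensor hP]
  exact Submodule.starProjection_eq_self_iff.mpr (hconc.annih_mem_Hinf hE hcb hx' ξ)

end Concave

end CovRep

end CStarCorr

end

theorem theorem3p8 {M E H : Type*} [NonUnitalCStarAlgebra M] [PartialOrder M] [StarOrderedRing M]
    [NormedAddCommGroup E] [NormedSpace ℂ E] [CompleteSpace E] [SMul Mᵐᵒᵖ E] [CStarModule Mᵐᵒᵖ E]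
    [CStarCorr.CStarCorrespondence M E]
    [NormedAddCommGroup H] [InnerProductSpace ℂ H] [CompleteSpace H]
    (hE : CStarCorr.InnerIdealEssential M E)
    (R : CStarCorr.CovRep M E H) (hcb : R.IsCompletelyBounded) (hconc : R.IsConcave) :
    ∃ hred : R.IsReducing R.Hinf,
      haveI : CompleteSpace R.Hinf := hred.completeSpace
      (R.restrict R.Hinf hred).IsIsometric ∧ (R.restrict R.Hinf hred).IsFullyCoisometric := by
  have hred := hconc.isReducing_Hinf hE hcb
  have : CompleteSpace R.Hinf := hred.completeSpace
  have hiso := hconc.restrict_isIsometric hE hcb hred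
  exact ⟨hred, hiso, hiso.isFullyCoisometric (hconc.tilde_restrict_surjective hE hcb hred)⟩
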